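/- All graphs are finite and simple. A leaf is a vertex of degree $1$, and a support vertex is a vertex adjacent to at least one leaf. For a graph $G$ and $D\subseteq V(G)$, let $N[D]$ be the set consisting of the vertices of $D$ and all their neighbours; $D$ is isolating if $G-N[D]$ contains no copy of $K_2$ as a subgraph, and the isolation number $\iota(G)$ is the size of a smallest isolating set of $G$. Let $\mathcal{F}$ be the family of trees obtained as follows. Take $r\ge 2$ disjoint copies of the path $P_3$, in each of which the vertices are labelled $a,b,c$ in order along the path, and $q\ge 0$ disjoint copies of the path $P_4$, in each of which the vertices are labelled $x,y,y,x$ in order along the path. Let $A$ and $X$ be the sets of the vertices labelled $a$ and $x$, respectively. A tree belongs to $\mathcal{F}$ if and only if (up to isomorphism) it is obtained from such copies by adding edges with both endpoints in $A\cup X$ so that no vertex of $A\cup X$ is a leaf of the resulting tree. A tree $T$ is obtained from a tree $T_0$ by adding twin leaves if $T$ arises from $T_0$ by adding zero or more new vertices, each of which is a leaf of $T$ having the same neighbourhood in $T$ as some leaf of $T_0$. **Proposition.** Let $T$ be a tree of order $n\ge 3$ with $\ell$ leaves and $s\ge 2$ support vertices. Then $\iota(T)=\dfrac{n-\ell+2s}{4}$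 if and only if $T$ is obtained by adding twin leaves to a tree in $\mathcal{F}$. -/

import Mathlib

namespace TreeIsolation

open SimpleGraph

/-- The set of leaves, i.e. of vertices of degree 1. -/
def leafSet {V : Type*} (G : SimpleGraph V) : Set V :=
  {v | (G.neighborSet v).ncard = 1}

/-- The set of support vertices, i.e. of vertices adjacent to at least one leaf. -/
def supportSet {V : Type*} (G : SimpleGraph V) : Set V :=
  {v | ∃ u ∈ leafSet G, G.Adj v u}

/-- The closed neighborhood `N[D]`: the vertices of `D` and all their neighbors. -/
def closedNbhd {V : Type*} (G : SimpleGraph V) (D : Set V) : Set V :=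
  {v | v ∈ D ∨ ∃ u ∈ D, G.Adj u v}

/-- `D` is `F`-isolating in `G`: no subgraph of `G - N[D]` is a copy of `F`. -/
def IsIsolating {V W : Type*} (F : SimpleGraph W) (G : SimpleGraph V) (D : Set V) : Prop :=
  F.Free (G.induce (closedNbhd G D)ᶜ)

/-- The `F`-isolation number `ι(G, F)`: the smallest size of an `F`-isolating set of `G`. -/
noncomputable def isolationNumberOf {V W : Type*} (F : SimpleGraph W) (G : SimpleGraph V) : ℕ :=
  sInf {k | ∃ D : Finset V, IsIsolating F G (D : Set V) ∧ D.card = k}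

/-- The isolation number `ι(G) = ι(G, K₂)`. -/
noncomputable def isolationNumber {V : Type*} (G : SimpleGraph V) : ℕ :=
  isolationNumberOf (completeGraph (Fin 2)) G

/-- The vertices of `r` copies of `P₃` and `s` copies of `P₄`. In each copy of `P₃`
the vertices `0, 1, 2` carry the labels `a, b, c`; in each copy of `P₄` the vertices
`0, 1, 2, 3` carry the labels `x, y, y, x`. -/
abbrev PathVertex (r s : ℕ) : Type := (Fin r × Fin 3) ⊕ (Fin s × Fin 4)

/-- The disjoint union of `r` copies of `P₃` and `s` copies of `P₄`. -/
def pathUnion (r s : ℕ) : SimpleGraph (PathVertex r s) :=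
  ((⊥ : SimpleGraph (Fin r)) □ pathGraph 3) ⊕g ((⊥ : SimpleGraph (Fin s)) □ pathGraph 4)

/-- The set `A ∪ X` of the vertices labelled `a` or `x`. -/
def setAX (r s : ℕ) : Set (PathVertex r s) :=
  {v | (∃ i, v = Sum.inl (i, 0)) ∨ (∃ j, v = Sum.inr (j, 0)) ∨ (∃ j, v = Sum.inr (j, 3))}

/-- `H` is a tree obtained from the disjoint union of `r` copies of `P₃` and `s` copies of `P₄`
by adding edges with endpoints in `A ∪ X` so that no vertex of `A ∪ X` is a leaf of `H`. -/
structure IsJoinOfPaths {r s : ℕ} (H : SimpleGraph (PathVertex r s)) : Prop where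
  isTree : H.IsTree
  pathUnion_le : pathUnion r s ≤ H
  added_edge : ∀ u v, H.Adj u v → ¬ (pathUnion r s).Adj u v → u ∈ setAX r s ∧ v ∈ setAX r s
  not_leaf : ∀ v ∈ setAX r s, v ∉ leafSet H

/-- The family `𝓕` of trees (up to isomorphism). -/
def InFamilyF {V : Type*} (T : SimpleGraph V) : Prop :=
  ∃ (r s : ℕ) (H : SimpleGraph (PathVertex r s)),
    2 ≤ r ∧ IsJoinOfPaths H ∧ Nonempty (T ≃g H)

/-- `T` is obtained from `T₀` by adding (zero or more) twin leaves: `T₀` is an induced subgraph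
of `T`, and each further vertex of `T` is a leaf of `T` with the same neighborhood as
some leaf of `T₀`. -/
def AddTwinLeaves {W V : Type*} (T₀ : SimpleGraph W) (T : SimpleGraph V) : Prop :=
  ∃ f : T₀ ↪g T, ∀ v ∉ Set.range f,
    v ∈ leafSet T ∧ ∃ u ∈ leafSet T₀, T.neighborSet v = T.neighborSet (f u)

end TreeIsolation

universe u

namespace TreeIsolation

open SimpleGraph Relation

variable {V : Type*}

/-! ### Isolating sets for `K₂` -/

/-! Root the tree at a support vertex, call the non-leaves the core and mark the support vertices. A
set that dominates every marked vertex and an end of every core edge is isolating. For a core vertex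
`v`, let `α v ≤ β v ≤ γ v ≤ δ v` be the optimal costs of the subtree below `v` when, respectively,
`v` is dominated from above, no extra condition is imposed, `v` has to be dominated, and `v` has to
be chosen. Summing over the children, `δ v ≤ 1 + ∑ α`, `α v ≤ ∑ β`, `γ v ≤ ∑ δ`, and `β v ≤ ∑ γ` for
unmarked `v`. Adding these shows that the four costs of `v` exceed those of its children by at most
1, or by at most 3 if `v` is marked (`total_le`). Summation over the core telescopes to `4 ι(T) ≤ n
- ℓ + 2s` (`four_mul_isolationNumber_le`).

If equality holds, there is no slack anywhere. For an unmarked vertex the chain `α ≤ β ≤ γ ≤ δ` then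
rises by at most 1 in total, and the place of the rise is the type of the vertex. Types of children
are forced: 3 is followed by a single 2, 2 by a single 1, 1 by 0's only, and 0 by exactly one 3 and
otherwise 0's. A marked vertex other than the root has type 3 and no child in the core; the root has
a single child, of type 1. So each unmarked chain 3, 2, 1 forms a `P₄` with its parent of type 0,
and each marked vertex forms a `P₃` with its one core neighbour and one of its leaves
(`Tight.exists_decomposition`, `IsStandard.exists_isJoinOfPaths`). The remaining leaves are twins.

Conversely, an isolating set meets each of `r + q` disjoint cells, one for each path, and `n - ℓ +
2s = 4(r + q)`, so the upper bound is attained. -/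

theorem isIsolating_iff {G : SimpleGraph V} {D : Set V} :
    IsIsolating (completeGraph (Fin 2)) G D ↔
      ∀ u v, G.Adj u v → u ∈ closedNbhd G D ∨ v ∈ closedNbhd G D := by
  constructor
  · intro h u v huv
    by_contra! hc
    refine h ⟨⟨⟨![⟨u, hc.1⟩, ⟨v, hc.2⟩], ?_⟩, ?_⟩⟩
    · intro a b hab
      fin_cases a <;> fin_cases b <;> simp_all [huv.symm]
    · intro a b hab
      have := huv.ne
      fin_cases a <;> fin_cases b <;> simp_all
  · rintro h ⟨f⟩
    have := f.toHom.map_rel (show (completeGraph (Fin 2)).Adj 0 1 by simp)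
    rcases h _ _ this with h | h
    · exact (f 0).2 h
    · exact (f 1).2 h

theorem closedNbhd_mono {G : SimpleGraph V} {D E : Set V} (h : D ⊆ E) :
    closedNbhd G D ⊆ closedNbhd G E := by
  rintro v (hv | ⟨u, hu, huv⟩)
  · exact Or.inl (h hv)
  · exact Or.inr ⟨u, h hu, huv⟩

theorem isolationNumber_le {G : SimpleGraph V} {D : Finset V}
    (h : IsIsolating (completeGraph (Fin 2)) G (D : Set V)) : isolationNumber G ≤ D.card :=
  Nat.sInf_le ⟨D, h, rfl⟩

theorem exists_card_eq_isolationNumber [Fintype V] (G : SimpleGraph V) :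
    ∃ D : Finset V, IsIsolating (completeGraph (Fin 2)) G (D : Set V) ∧
      D.card = isolationNumber G := by
  have : {k | ∃ D : Finset V, IsIsolating (completeGraph (Fin 2)) G (D : Set V) ∧
      D.card = k}.Nonempty :=
    ⟨_, Finset.univ, isIsolating_iff.2 fun u _ _ => Or.inl (Or.inl (by simp)), rfl⟩
  exact Nat.sInf_mem this

/-! ### Rooted trees with marked vertices -/

/-- A rooting of `T`, together with a set `core` of vertices that contains the root and is closed
under taking parents, and a set of marked vertices of the core that contains the root. -/
structure MarkedRooting (T : SimpleGraph V) where
  /-- the root -/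
  root : V
  /-- the parent of a vertex other than the root -/
  parent : V → V
  /-- the distance to the root -/
  level : V → ℕ
  /-- the vertices that may be dominated -/
  core : Finset V
  /-- the vertices that have to be dominated -/
  marked : Finset V
  level_eq : ∀ v, v ≠ root → level v = level (parent v) + 1
  adj_iff : ∀ u v, T.Adj u v ↔ (u ≠ root ∧ parent u = v) ∨ (v ≠ root ∧ parent v = u)
  parent_mem : ∀ v ∈ core, v ≠ root → parent v ∈ core
  root_mem_marked : root ∈ marked
  marked_subset : marked ⊆ core

/-- A neighbour one step nearer to `r` serves as parent. The parent edges already form a connected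
spanning subgraph, and a tree is minimally connected, so it has no other edges. -/
theorem exists_parent {T : SimpleGraph V} (hT : T.IsTree) (r : V) :
    ∃ parent : V → V, (∀ v, v ≠ r → T.dist v r = T.dist (parent v) r + 1) ∧
      ∀ u v, T.Adj u v ↔ (u ≠ r ∧ parent u = v) ∨ (v ≠ r ∧ parent v = u) := by
  have key : ∀ v, ∃ w, v ≠ r → T.Adj v w ∧ T.dist v r = T.dist w r + 1 := by
    intro v
    by_cases hv : v = r
    · exact ⟨v, fun h => absurd hv h⟩
    · obtain ⟨p, hp⟩ := hT.1.exists_walk_length_eq_dist v r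
      cases p with
      | nil => exact absurd rfl hv
      | @cons _ w _ h p =>
        refine ⟨w, fun _ => ⟨h, ?_⟩⟩
        have h1 := dist_le p
        have h2 := hT.1.dist_triangle (u := v) (v := w) (w := r)
        have h3 := dist_eq_one_iff_adj.2 h
        simp only [Walk.length_cons] at hp
        omega
  choose parent hpar using key
  refine ⟨parent, fun v hv => (hpar v hv).2, ?_⟩
  let G : SimpleGraph V :=
    { Adj := fun u v => (u ≠ r ∧ parent u = v) ∨ (v ≠ r ∧ parent v = u)
      symm := ⟨fun u v h => h.symm⟩
      loopless := ⟨by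
        intro v h
        have h' : v ≠ r ∧ parent v = v := by tauto
        have := (hpar v h'.1).2
        rw [h'.2] at this
        omega⟩ }
  have hle : G ≤ T := by
    rintro u v (⟨h, rfl⟩ | ⟨h, rfl⟩)
    · exact (hpar u h).1
    · exact (hpar v h).1.symm
  have hreach : ∀ n v, T.dist v r = n → G.Reachable v r := by
    intro n
    induction n with
    | zero =>
      intro v hv
      rw [hT.1.dist_eq_zero_iff] at hv
      rw [hv]
    | succ n ih =>
      intro v hv
      have hvr : v ≠ r := by
        rintro rfl
        simp at hv
      have hadj : G.Adj v (parent v) := Or.inl ⟨hvr, rfl⟩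
      exact hadj.reachable.trans (ih _ (by have := (hpar v hvr).2; omega))
  have hG : G.Connected :=
    { preconnected := fun u v => (hreach _ u rfl).trans (hreach _ v rfl).symm
      nonempty := ⟨r⟩ }
  have := (isTree_iff_minimal_connected.1 hT).2 hG hle
  exact fun u v => ⟨fun h => this h, fun h => hle h⟩

/-- The marked vertices of `X` are in `N[Q]`, and so is an endpoint of every edge inside `X`. -/
def Covers (T : SimpleGraph V) (M X Q : Set V) : Prop :=
  (∀ u ∈ X, u ∈ M → u ∈ closedNbhd T Q) ∧
    ∀ u ∈ X, ∀ w ∈ X, T.Adj u w → u ∈ closedNbhd T Q ∨ w ∈ closedNbhd T Q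

/-- The least cardinality of a finite set with the property `P`. -/
noncomputable def minCard (P : Set V → Prop) : ℕ :=
  sInf {k | ∃ D : Finset V, P D ∧ D.card = k}

theorem minCard_le {P : Set V → Prop} {D : Finset V} (h : P D) : minCard P ≤ D.card :=
  Nat.sInf_le ⟨D, h, rfl⟩

theorem exists_card_eq_minCard [Fintype V] {P : Set V → Prop} (h : P Set.univ) :
    ∃ D : Finset V, P D ∧ D.card = minCard P :=
  Nat.sInf_mem (s := {k | ∃ D : Finset V, P D ∧ D.card = k})
    ⟨_, Finset.univ, by simpa using h, rfl⟩

/-- `hP` guarantees a minimizer; otherwise `minCard P` could be the junk value `sInf ∅ = 0`. -/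
theorem minCard_anti [Fintype V] {P P' : Set V → Prop} (hP : P Set.univ) (h : ∀ Q, P Q → P' Q) :
    minCard P' ≤ minCard P := by
  obtain ⟨D, hD, hc⟩ := exists_card_eq_minCard hP
  exact hc ▸ minCard_le (h _ hD)

/-- Common source of the recurrences: unite `E` with an optimal set for each `c ∈ s`. -/
theorem minCard_le_sum [Fintype V] [DecidableEq V] {s : Finset V} {P : V → Set V → Prop}
    {P' : Set V → Prop} (E : Finset V) (hP : ∀ c ∈ s, P c Set.univ)
    (h : ∀ Q : Set V, ↑E ⊆ Q → (∀ c ∈ s, ∃ Q' ⊆ Q, P c Q') → P' Q) :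
    minCard P' ≤ E.card + ∑ c ∈ s, minCard (P c) := by
  have : ∀ c, ∃ D : Finset V, c ∈ s → P c D ∧ D.card = minCard (P c) := by
    intro c
    by_cases hc : c ∈ s
    · obtain ⟨D, hD⟩ := exists_card_eq_minCard (hP c hc)
      exact ⟨D, fun _ => hD⟩
    · exact ⟨∅, fun h => absurd h hc⟩
  choose D hD using this
  calc minCard P' ≤ (E ∪ s.biUnion D).card := by
        refine minCard_le (h _ (by simp) fun c hc => ⟨D c, ?_, (hD c hc).1⟩)
        intro x hx
        simp only [Finset.coe_union, Set.mem_union, Finset.mem_coe, Finset.mem_biUnion]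
        exact Or.inr ⟨c, hc, hx⟩
    _ ≤ E.card + (s.biUnion D).card := Finset.card_union_le _ _
    _ ≤ E.card + ∑ c ∈ s, (D c).card := by gcongr; exact Finset.card_biUnion_le
    _ = E.card + ∑ c ∈ s, minCard (P c) := by
        rw [Finset.sum_congr rfl fun c hc => (hD c hc).2]

theorem Covers.mono {T : SimpleGraph V} {M X Q Q' : Set V} (h : Covers T M X Q) (hQ : Q ⊆ Q') :
    Covers T M X Q' :=
  ⟨fun u hu hm => closedNbhd_mono hQ (h.1 u hu hm), fun u hu w hw huw =>
    (h.2 u hu w hw huw).imp (fun h => closedNbhd_mono hQ h) fun h => closedNbhd_mono hQ h⟩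

theorem Covers.anti {T : SimpleGraph V} {M X X' Q : Set V} (h : Covers T M X Q) (hX : X' ⊆ X) :
    Covers T M X' Q :=
  ⟨fun u hu => h.1 u (hX hu), fun u hu w hw => h.2 u (hX hu) w (hX hw)⟩

theorem covers_univ {T : SimpleGraph V} {M X : Set V} : Covers T M X Set.univ :=
  ⟨fun _ _ _ => Or.inl trivial, fun _ _ _ _ _ => Or.inl (Or.inl trivial)⟩

/-! ### Subtree costs and their recurrences -/

namespace MarkedRooting

variable {T : SimpleGraph V} (R : MarkedRooting T)

theorem root_mem : R.root ∈ R.core := R.marked_subset R.root_mem_marked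

open Classical in
/-- The children of `v` in the core. -/
noncomputable def children (v : V) : Finset V :=
  {c ∈ R.core | c ≠ R.root ∧ R.parent c = v}

theorem mem_children {v c : V} :
    c ∈ R.children v ↔ c ∈ R.core ∧ c ≠ R.root ∧ R.parent c = v := by
  simp [children]

/-- The descendants of `v` in the core, including `v`. -/
def desc (v : V) : Set V :=
  {u | u ∈ R.core ∧ ReflTransGen (fun a b => a ≠ R.root ∧ R.parent a = b) u v}

variable {R}

theorem adj_child {v c : V} (h : c ∈ R.children v) : T.Adj v c :=
  (R.adj_iff _ _).2 (Or.inr (R.mem_children.1 h).2)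

theorem level_le_of_mem_desc {u v : V} (h : u ∈ R.desc v) : R.level v ≤ R.level u := by
  obtain ⟨_, h⟩ := h
  induction h with
  | refl => rfl
  | tail _ h ih =>
    have := R.level_eq _ h.1
    rw [h.2] at this
    omega

theorem eq_or_mem_desc_child {u v : V} (h : u ∈ R.desc v) :
    u = v ∨ ∃ c ∈ R.children v, u ∈ R.desc c := by
  obtain ⟨hu, h⟩ := h
  rcases h.cases_tail with h | ⟨c, huc, hc⟩
  · exact Or.inl h.symm
  · refine Or.inr ⟨c, R.mem_children.2 ⟨?_, hc⟩, hu, huc⟩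
    clear hc h
    induction huc with
    | refl => exact hu
    | tail _ h ih => exact h.2 ▸ R.parent_mem _ ih h.1

theorem parent_mem_desc {u v : V} (h : u ∈ R.desc v) (huv : u ≠ v) : R.parent u ∈ R.desc v := by
  obtain ⟨hu, h⟩ := h
  rcases h.cases_head with h | ⟨c, huc, hc⟩
  · exact absurd h huv
  · rw [huc.2]
    exact ⟨huc.2 ▸ R.parent_mem _ hu huc.1, hc⟩

theorem mem_desc_root {u : V} (hu : u ∈ R.core) : u ∈ R.desc R.root := by
  refine ⟨hu, ?_⟩
  generalize hn : R.level u = n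
  induction n generalizing u with
  | zero =>
    by_cases h : u = R.root
    · rw [h]
    · have := R.level_eq u h
      omega
  | succ n ih =>
    by_cases h : u = R.root
    · rw [h]
    · have := R.level_eq u h
      exact .head ⟨h, rfl⟩ (ih (R.parent_mem u hu h) (by omega))

/-- Edges inside `desc v` are incident with `v` or inside `desc c` for a child `c`. -/
theorem edge_cases {u w v : V} (hu : u ∈ R.desc v) (hw : w ∈ R.desc v) (h : T.Adj u w) :
    (u = v ∧ w ∈ R.children v) ∨ (w = v ∧ u ∈ R.children v) ∨
      ∃ c ∈ R.children v, u ∈ R.desc c ∧ w ∈ R.desc c := by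
  have key : ∀ u w, u ∈ R.desc v → w ∈ R.desc v → u ≠ R.root → R.parent u = w →
      (w = v ∧ u ∈ R.children v) ∨ ∃ c ∈ R.children v, u ∈ R.desc c ∧ w ∈ R.desc c := by
    rintro u w hu hw hr rfl
    rcases eq_or_mem_desc_child hu with rfl | ⟨c, hc, huc⟩
    · have := level_le_of_mem_desc hw
      have := R.level_eq u hr
      omega
    · by_cases h : u = c
      · subst h
        exact Or.inl ⟨(R.mem_children.1 hc).2.2, (R.mem_children.1 hc).2.2 ▸ hc⟩
      · exact Or.inr ⟨c, hc, huc, parent_mem_desc huc h⟩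
  rcases (R.adj_iff u w).1 h with h | h
  · rcases key u w hu hw h.1 h.2 with h | h <;> tauto
  · rcases key w u hw hu h.1 h.2 with h | ⟨c, h⟩
    · tauto
    · exact Or.inr (Or.inr ⟨c, h.1, h.2.2, h.2.1⟩)

variable (R)

/-- The least size of a set that takes care of `desc v` if `v` is dominated from above. -/
noncomputable def α (v : V) : ℕ := minCard fun Q => Covers T R.marked (R.desc v \ {v}) Q

/-- The least size of a set that takes care of `desc v`. -/
noncomputable def β (v : V) : ℕ := minCard fun Q => Covers T R.marked (R.desc v) Q

/-- The least size of a set that takes care of `desc v` and dominates `v`. -/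
noncomputable def γ (v : V) : ℕ :=
  minCard fun Q => Covers T R.marked (R.desc v) Q ∧ v ∈ closedNbhd T Q

/-- The least size of a set that takes care of `desc v` and contains `v`. -/
noncomputable def δ (v : V) : ℕ := minCard fun Q => Covers T R.marked (R.desc v) Q ∧ v ∈ Q

variable [Fintype V]

theorem α_le_β (v : V) : R.α v ≤ R.β v :=
  minCard_anti covers_univ fun _ h => h.anti Set.sdiff_subset

theorem β_le_γ (v : V) : R.β v ≤ R.γ v :=
  minCard_anti ⟨covers_univ, Or.inl trivial⟩ fun _ h => h.1

theorem γ_le_δ (v : V) : R.γ v ≤ R.δ v :=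
  minCard_anti ⟨covers_univ, trivial⟩ fun _ h => ⟨h.1, Or.inl h.2⟩

/-- Choosing `v` dominates all its children from above, so each child only costs `α`. -/
theorem δ_le (v : V) : R.δ v ≤ 1 + ∑ c ∈ R.children v, R.α c := by
  classical
  refine minCard_le_sum {v} (fun _ _ => covers_univ) fun Q hE hQ => ?_
  have hv : v ∈ Q := hE (by simp)
  have hv' : v ∈ closedNbhd T Q := Or.inl hv
  have hch : ∀ c ∈ R.children v, c ∈ closedNbhd T Q := fun c hc => Or.inr ⟨v, hv, adj_child hc⟩
  refine ⟨⟨fun u hu hm => ?_, fun u hu w hw huw => ?_⟩, hv⟩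
  · rcases eq_or_mem_desc_child hu with rfl | ⟨c, hc, huc⟩
    · exact hv'
    · obtain ⟨Q', hQQ, hQ'⟩ := hQ c hc
      by_cases h : u = c
      · exact h ▸ hch c hc
      · exact (hQ'.mono hQQ).1 u ⟨huc, h⟩ hm
  · rcases edge_cases hu hw huw with h | h | ⟨c, hc, huc, hwc⟩
    · exact Or.inl (h.1 ▸ hv')
    · exact Or.inr (h.1 ▸ hv')
    · obtain ⟨Q', hQQ, hQ'⟩ := hQ c hc
      by_cases h : u = c
      · exact Or.inl (h ▸ hch c hc)
      by_cases h' : w = c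
      · exact Or.inr (h' ▸ hch c hc)
      exact (hQ'.mono hQQ).2 u ⟨huc, h⟩ w ⟨hwc, h'⟩ huw

/-- Without `v`, every remaining edge lies in the subtree of a single child. -/
theorem α_le (v : V) : R.α v ≤ ∑ c ∈ R.children v, R.β c := by
  classical
  have := minCard_le_sum (P' := fun Q => Covers T R.marked (R.desc v \ {v}) Q) ∅
    (fun c (_ : c ∈ R.children v) => covers_univ (T := T) (M := R.marked) (X := R.desc c))
    fun Q _ hQ => ?_
  · simpa [α, β] using this
  refine ⟨fun u hu hm => ?_, fun u hu w hw huw => ?_⟩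
  · rcases eq_or_mem_desc_child hu.1 with h | ⟨c, hc, huc⟩
    · exact absurd h hu.2
    · obtain ⟨Q', hQQ, hQ'⟩ := hQ c hc
      exact (hQ'.mono hQQ).1 u huc hm
  · rcases edge_cases hu.1 hw.1 huw with h | h | ⟨c, hc, huc, hwc⟩
    · exact absurd h.1 hu.2
    · exact absurd h.1 hw.2
    · obtain ⟨Q', hQQ, hQ'⟩ := hQ c hc
      exact (hQ'.mono hQQ).2 u huc w hwc huw

/-- Choosing `c₀` dominates `v` and thereby settles all edges at `v`; the other children need
nothing beyond `β`. The freedom in `c₀` is what forces single children in the equality case. -/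
theorem γ_le [DecidableEq V] {v c₀ : V} (hc₀ : c₀ ∈ R.children v) :
    R.γ v ≤ R.δ c₀ + ∑ c ∈ (R.children v).erase c₀, R.β c := by
  obtain ⟨E, hE, hcard⟩ := exists_card_eq_minCard
    (P := fun Q => Covers T R.marked (R.desc c₀) Q ∧ c₀ ∈ Q) ⟨covers_univ, trivial⟩
  rw [δ, ← hcard]
  refine minCard_le_sum E (fun _ _ => covers_univ) fun Q hEQ hQ => ?_
  have hc : ∀ c ∈ R.children v, Covers T R.marked (R.desc c) Q := by
    intro c hc
    by_cases h : c = c₀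
    · exact h ▸ hE.1.mono hEQ
    · obtain ⟨Q', hQQ, hQ'⟩ := hQ c (Finset.mem_erase.2 ⟨h, hc⟩)
      exact hQ'.mono hQQ
  have hv : v ∈ closedNbhd T Q := Or.inr ⟨c₀, hEQ hE.2, (adj_child hc₀).symm⟩
  refine ⟨⟨fun u hu hm => ?_, fun u hu w hw huw => ?_⟩, hv⟩
  · rcases eq_or_mem_desc_child hu with rfl | ⟨c, hcv, huc⟩
    · exact hv
    · exact (hc c hcv).1 u huc hm
  · rcases edge_cases hu hw huw with h | h | ⟨c, hcv, huc, hwc⟩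
    · exact Or.inl (h.1 ▸ hv)
    · exact Or.inr (h.1 ▸ hv)
    · exact (hc c hcv).2 u huc w hwc huw

/-- If all children are dominated, the edges from `v` to them are settled, and an unmarked `v` need
not be dominated itself. -/
theorem β_le {v : V} (hv : v ∉ R.marked) : R.β v ≤ ∑ c ∈ R.children v, R.γ c := by
  classical
  have := minCard_le_sum (P' := fun Q => Covers T R.marked (R.desc v) Q) ∅
    (P := fun c Q => Covers T R.marked (R.desc c) Q ∧ c ∈ closedNbhd T Q)
    (s := R.children v) (fun c _ => ⟨covers_univ, Or.inl trivial⟩)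
    fun Q _ hQ => ?_
  · simpa [β, γ] using this
  have hch : ∀ c ∈ R.children v, c ∈ closedNbhd T Q := fun c hc => by
    obtain ⟨Q', hQQ, hQ'⟩ := hQ c hc
    exact closedNbhd_mono hQQ hQ'.2
  refine ⟨fun u hu hm => ?_, fun u hu w hw huw => ?_⟩
  · rcases eq_or_mem_desc_child hu with rfl | ⟨c, hc, huc⟩
    · exact absurd hm hv
    · obtain ⟨Q', hQQ, hQ'⟩ := hQ c hc
      exact (hQ'.1.mono hQQ).1 u huc hm
  · rcases edge_cases hu hw huw with h | h | ⟨c, hc, huc, hwc⟩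
    · exact Or.inr (hch w h.2)
    · exact Or.inl (hch u h.2)
    · obtain ⟨Q', hQQ, hQ'⟩ := hQ c hc
      exact (hQ'.1.mono hQQ).2 u huc w hwc huw

theorem γ_le_sum_δ {v : V} (hv : (R.children v).Nonempty) :
    R.γ v ≤ ∑ c ∈ R.children v, R.δ c := by
  classical
  obtain ⟨c₀, hc₀⟩ := hv
  refine (R.γ_le hc₀).trans ?_
  rw [← Finset.add_sum_erase _ _ hc₀]
  gcongr with c
  exact (R.β_le_γ c).trans (R.γ_le_δ c)

theorem exists_card_eq_β_root : ∃ Q : Finset V, Covers T R.marked R.core Q ∧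
    Q.card = R.β R.root := by
  obtain ⟨Q, hQ, hc⟩ := exists_card_eq_minCard
    (P := fun Q => Covers T R.marked (R.desc R.root) Q) covers_univ
  exact ⟨Q, hQ.anti fun u hu => mem_desc_root hu, hc⟩

end MarkedRooting

/-! ### Pointwise comparison of sums that are equal or differ by one -/

theorem exists_unique_increment {s : Finset V} {f g : V → ℕ} (h : ∀ c ∈ s, f c ≤ g c)
    (hs : ∑ c ∈ s, g c = ∑ c ∈ s, f c + 1) :
    ∃ c ∈ s, g c = f c + 1 ∧ ∀ c' ∈ s, c' ≠ c → g c' = f c' := by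
  classical
  have hlt : ∃ c ∈ s, f c < g c := by
    by_contra! hc
    have := Finset.sum_le_sum hc
    omega
  obtain ⟨c, hc, hlt⟩ := hlt
  have h1 := Finset.add_sum_erase s f hc
  have h2 := Finset.add_sum_erase s g hc
  have h' : ∀ x ∈ s.erase c, f x ≤ g x := fun x hx => h x (Finset.mem_of_mem_erase hx)
  have h3 := Finset.sum_le_sum h'
  refine ⟨c, hc, by omega, fun c' hc' hne => ?_⟩
  exact (((Finset.sum_eq_sum_iff_of_le h').1 (by omega)) c' (Finset.mem_erase.2 ⟨hne, hc'⟩)).symm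

theorem eq_of_sum_eq {s : Finset V} {f g : V → ℕ} (h : ∀ c ∈ s, f c ≤ g c)
    (hs : ∑ c ∈ s, g c = ∑ c ∈ s, f c) : ∀ c ∈ s, g c = f c :=
  fun c hc => ((Finset.sum_eq_sum_iff_of_le h).1 hs.symm c hc).symm

/-- `hmin` has the shape of `γ_le`. At an index `d` without increment its right side would be `∑ f`,
one less than `∑ g`. -/
theorem exists_eq_singleton_of_increment [DecidableEq V] {s : Finset V} {f g : V → ℕ}
    (h : ∀ c ∈ s, f c ≤ g c) (hs : ∑ c ∈ s, g c = ∑ c ∈ s, f c + 1)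
    (hmin : ∀ c ∈ s, ∑ c ∈ s, g c ≤ g c + ∑ c' ∈ s.erase c, f c') :
    ∃ c, s = {c} ∧ g c = f c + 1 := by
  obtain ⟨c, hc, hgc, hc'⟩ := exists_unique_increment h hs
  refine ⟨c, Finset.eq_singleton_iff_unique_mem.2 ⟨hc, fun d hd => ?_⟩, hgc⟩
  by_contra hne
  have h1 := hmin d hd
  have h2 := hc' d hd hne
  have h3 := Finset.add_sum_erase s f hd
  omega

/-! ### The weight bound and its equality case -/

namespace MarkedRooting

variable {T : SimpleGraph V} (R : MarkedRooting T)

/-- The root and the unmarked vertices of the core have children. -/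
def HasChildren : Prop := ∀ v ∈ R.core, v ∉ R.marked ∨ v = R.root → (R.children v).Nonempty

open Classical in
/-- Marked vertices have weight 3, the other vertices have weight 1. -/
noncomputable def weight (v : V) : ℕ := if v ∈ R.marked then 3 else 1

/-- The sum of the four sizes attached to a vertex. -/
noncomputable def total (v : V) : ℕ := R.α v + R.β v + R.γ v + R.δ v

theorem sum_weight : ∑ v ∈ R.core, R.weight v = R.core.card + 2 * R.marked.card := by
  classical
  have : ∀ v ∈ R.core, R.weight v = 1 + if v ∈ R.marked then 2 else 0 := by
    intro v _
    unfold weight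
    split_ifs <;> rfl
  rw [Finset.sum_congr rfl this, Finset.sum_add_distrib, Finset.sum_ite_mem,
    Finset.inter_eq_right.2 R.marked_subset]
  simp [mul_comm]

theorem sum_total (v : V) : ∑ c ∈ R.children v, R.total c = ∑ c ∈ R.children v, R.α c +
    ∑ c ∈ R.children v, R.β c + ∑ c ∈ R.children v, R.γ c + ∑ c ∈ R.children v, R.δ c := by
  simp only [total, Finset.sum_add_distrib]

variable [Fintype V]

theorem sum_α_le_sum_β (s : Finset V) : ∑ c ∈ s, R.α c ≤ ∑ c ∈ s, R.β c :=
  Finset.sum_le_sum fun c _ => R.α_le_β c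

theorem sum_β_le_sum_γ (s : Finset V) : ∑ c ∈ s, R.β c ≤ ∑ c ∈ s, R.γ c :=
  Finset.sum_le_sum fun c _ => R.β_le_γ c

theorem sum_γ_le_sum_δ (s : Finset V) : ∑ c ∈ s, R.γ c ≤ ∑ c ∈ s, R.δ c :=
  Finset.sum_le_sum fun c _ => R.γ_le_δ c

variable {R}

/-- For unmarked `v`, add the four recurrences. For marked `v` the bound on `β v` is missing;
bounding `β v` and `γ v` by `δ v` gives `∑ β + 3 (1 + ∑ α)`, hence the weight 3. -/
theorem total_le (h : R.HasChildren) {v : V} (hv : v ∈ R.core) :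
    R.total v ≤ R.weight v + ∑ c ∈ R.children v, R.total c := by
  have := R.sum_α_le_sum_β (R.children v)
  have := R.sum_β_le_sum_γ (R.children v)
  have := R.sum_γ_le_sum_δ (R.children v)
  have := R.δ_le v
  have := R.α_le v
  have := R.β_le_γ v
  have := R.γ_le_δ v
  rw [sum_total, total, weight]
  split_ifs with hm
  · omega
  · have := R.β_le hm
    have := R.γ_le_sum_δ (h v hv (Or.inl hm))
    omega

/-- Only `β` matters at the root: `4 β ≤ 3 δ + γ ≤ 3 (1 + ∑ α) + ∑ δ`. -/
theorem four_mul_β_root_le (h : R.HasChildren) :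
    4 * R.β R.root ≤ 3 + ∑ c ∈ R.children R.root, R.total c := by
  have := R.sum_α_le_sum_β (R.children R.root)
  have := R.sum_β_le_sum_γ (R.children R.root)
  have := R.sum_γ_le_sum_δ (R.children R.root)
  have := R.δ_le R.root
  have := R.β_le_γ R.root
  have := R.γ_le_δ R.root
  have := R.γ_le_sum_δ (h _ R.root_mem (Or.inr rfl))
  rw [sum_total]
  omega

-- Each core vertex other than the root is a child of exactly one core vertex; this makes the sum of
-- the local bounds telescope.
omit [Fintype V] in
theorem sum_children_root_add [DecidableEq V] (f : V → ℕ) :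
    ∑ c ∈ R.children R.root, f c + ∑ v ∈ R.core.erase R.root, ∑ c ∈ R.children v, f c =
      ∑ v ∈ R.core.erase R.root, f v := by
  rw [Finset.add_sum_erase _ (fun v => ∑ c ∈ R.children v, f c) R.root_mem,
    ← Finset.sum_fiberwise_of_maps_to (s := R.core.erase R.root) (t := R.core) (g := R.parent)
      (fun v hv => R.parent_mem v (Finset.mem_of_mem_erase hv) (Finset.ne_of_mem_erase hv))]
  refine Finset.sum_congr rfl fun v _ => Finset.sum_congr ?_ fun _ _ => rfl
  ext c
  simp only [mem_children, Finset.mem_filter, Finset.mem_erase]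
  tauto

/-- The general upper bound. -/
theorem four_mul_β_root_le_sum (h : R.HasChildren) :
    4 * R.β R.root ≤ ∑ v ∈ R.core, R.weight v := by
  classical
  have h1 := Finset.sum_le_sum fun v (hv : v ∈ R.core.erase R.root) =>
    total_le h (Finset.mem_of_mem_erase hv)
  rw [Finset.sum_add_distrib, ← sum_children_root_add] at h1
  have h2 := four_mul_β_root_le h
  have h3 := Finset.add_sum_erase R.core R.weight R.root_mem
  have h4 : R.weight R.root = 3 := if_pos R.root_mem_marked
  omega

variable (R) in
/-- Equality holds in the general upper bound. -/
def Tight : Prop := R.HasChildren ∧ 4 * R.β R.root = ∑ v ∈ R.core, R.weight v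

/-- The telescoped bound is a sum of local inequalities, so global equality leaves no slack in any
of them. -/
theorem Tight.root_eq (h : R.Tight) :
    4 * R.β R.root = 3 + ∑ c ∈ R.children R.root, R.total c := by
  classical
  have h1 := Finset.sum_le_sum fun v (hv : v ∈ R.core.erase R.root) =>
    total_le h.1 (Finset.mem_of_mem_erase hv)
  rw [Finset.sum_add_distrib, ← sum_children_root_add] at h1
  have h2 := four_mul_β_root_le h.1
  have h3 := Finset.add_sum_erase R.core R.weight R.root_mem
  have h4 : R.weight R.root = 3 := if_pos R.root_mem_marked
  have := h.2
  omega

theorem Tight.total_eq (h : R.Tight) {v : V} (hv : v ∈ R.core) (hvr : v ≠ R.root) :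
    R.total v = R.weight v + ∑ c ∈ R.children v, R.total c := by
  classical
  have h0 : ∀ v ∈ R.core.erase R.root, _ := fun v hv =>
    total_le h.1 (Finset.mem_of_mem_erase hv)
  have h1 := Finset.sum_le_sum h0
  refine ((Finset.sum_eq_sum_iff_of_le h0).1 ?_) v (Finset.mem_erase.2 ⟨hvr, hv⟩)
  rw [Finset.sum_add_distrib, ← sum_children_root_add] at h1 ⊢
  have h2 := four_mul_β_root_le h.1
  have h3 := Finset.add_sum_erase R.core R.weight R.root_mem
  have h4 : R.weight R.root = 3 := if_pos R.root_mem_marked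
  have := h.2
  omega

variable (R) in
/-- The type of a vertex; see `Tight.hasType`. -/
def HasType (i : Fin 4) (v : V) : Prop :=
  R.β v = R.α v + (if i = 3 then 1 else 0) ∧ R.γ v = R.β v + (if i = 2 then 1 else 0) ∧
    R.δ v = R.γ v + (if i = 1 then 1 else 0)

omit [Fintype V] in
theorem HasType.eq {i j : Fin 4} {v : V} (hi : R.HasType i v) (hj : R.HasType j v) : i = j := by
  obtain ⟨h1, h2, h3⟩ := hi
  obtain ⟨h4, h5, h6⟩ := hj
  fin_cases i <;> fin_cases j <;> simp_all

/-- Equality in `4 β ≤ 3 (1 + ∑ α) + ∑ δ ≤ 3 + ∑ total` forces `∑ α = ∑ β = ∑ γ` and `∑ δ = 1 + ∑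
α`. A further child would serve as a cheaper `c₀` in `γ_le`. -/
theorem Tight.root (h : R.Tight) : ∃ c, R.children R.root = {c} ∧ R.HasType 1 c := by
  classical
  have h1 := R.sum_α_le_sum_β (R.children R.root)
  have h2 := R.sum_β_le_sum_γ (R.children R.root)
  have h3 := R.sum_γ_le_sum_δ (R.children R.root)
  have h4 := R.δ_le R.root
  have h5 := R.β_le_γ R.root
  have h6 := R.γ_le_δ R.root
  have h7 := R.γ_le_sum_δ (h.1 _ R.root_mem (Or.inr rfl))
  have h8 := h.root_eq
  rw [sum_total] at h8
  have e1 := eq_of_sum_eq (fun c _ => R.α_le_β c) (s := R.children R.root) (by omega)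
  have e2 := eq_of_sum_eq (fun c _ => R.β_le_γ c) (s := R.children R.root) (by omega)
  obtain ⟨c, hs, hc⟩ := exists_eq_singleton_of_increment (s := R.children R.root)
    (f := R.β) (g := R.δ) (fun c _ => (R.β_le_γ c).trans (R.γ_le_δ c)) (by omega)
    (fun c hc => by have := R.γ_le hc; omega)
  have hm : c ∈ R.children R.root := by simp [hs]
  have := e1 c hm
  have := e2 c hm
  refine ⟨c, hs, ?_, ?_, ?_⟩ <;> simp <;> omega

/-- Equality makes all four sums over the children equal and `γ v = 1 + ∑ α`, but `γ_le` at any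
child would give `γ v ≤ ∑ α`. -/
theorem Tight.marked (h : R.Tight) {v : V} (hv : v ∈ R.marked) (hvr : v ≠ R.root) :
    R.children v = ∅ ∧ R.HasType 3 v := by
  classical
  have h1 := R.sum_α_le_sum_β (R.children v)
  have h2 := R.sum_β_le_sum_γ (R.children v)
  have h3 := R.sum_γ_le_sum_δ (R.children v)
  have h4 := R.δ_le v
  have h5 := R.β_le_γ v
  have h6 := R.γ_le_δ v
  have h7 := R.α_le v
  have h8 := h.total_eq (R.marked_subset hv) hvr
  rw [sum_total, total, weight, if_pos hv] at h8
  have h9 : R.children v = ∅ := by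
    by_contra hne
    obtain ⟨c, hc⟩ := Finset.nonempty_iff_ne_empty.2 hne
    have e2 := eq_of_sum_eq (fun c _ => R.β_le_γ c) (s := R.children v) (by omega) c hc
    have e3 := eq_of_sum_eq (fun c _ => R.γ_le_δ c) (s := R.children v) (by omega) c hc
    have := R.γ_le hc
    have := Finset.add_sum_erase _ R.β hc
    omega
  refine ⟨h9, ?_⟩
  simp only [h9, Finset.sum_empty] at *
  refine ⟨?_, ?_, ?_⟩ <;> simp <;> omega

theorem Tight.unmarked (h : R.Tight) {v : V} (hv : v ∈ R.core) (hm : v ∉ R.marked) :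
    (R.α v = ∑ c ∈ R.children v, R.β c ∧ R.β v = ∑ c ∈ R.children v, R.γ c) ∧
      R.γ v = ∑ c ∈ R.children v, R.δ c ∧ R.δ v = 1 + ∑ c ∈ R.children v, R.α c := by
  have hvr : v ≠ R.root := by
    rintro rfl
    exact hm R.root_mem_marked
  have h4 := R.δ_le v
  have h5 := R.β_le hm
  have h6 := R.γ_le_sum_δ (h.1 v hv (Or.inl hm))
  have h7 := R.α_le v
  have h8 := h.total_eq hv hvr
  rw [sum_total, total, weight, if_neg hm] at h8
  omega

/-- Since `δ v = 1 + ∑ α ≤ 1 + ∑ β = 1 + α v`, the chain from `α v` to `δ v` rises at most once, by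
1. -/
theorem Tight.hasType (h : R.Tight) {v : V} (hv : v ∈ R.core) (hm : v ∉ R.marked) :
    ∃ i, R.HasType i v := by
  have h1 := R.sum_α_le_sum_β (R.children v)
  have := h.unmarked hv hm
  have := R.α_le_β v
  have := R.β_le_γ v
  have := R.γ_le_δ v
  by_cases a : R.β v = R.α v
  · by_cases b : R.γ v = R.β v
    · by_cases c : R.δ v = R.γ v
      · exact ⟨0, by refine ⟨?_, ?_, ?_⟩ <;> simp <;> omega⟩
      · exact ⟨1, by refine ⟨?_, ?_, ?_⟩ <;> simp <;> omega⟩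
    · exact ⟨2, by refine ⟨?_, ?_, ?_⟩ <;> simp <;> omega⟩
  · exact ⟨3, by refine ⟨?_, ?_, ?_⟩ <;> simp <;> omega⟩

/-- The recurrences, now equalities, express the increments at `v` by those of its children: `β - α`
is `∑ (γ - β)`, `γ - β` is `∑ (δ - γ)`, and `δ - γ` is `1 - ∑ (δ - α)`. For type 0 this leaves `∑ (β
- α) = 1`. The other types are read off in the same way. -/
theorem Tight.children_of_zero (h : R.Tight) {v : V} (hv : v ∈ R.core) (hm : v ∉ R.marked)
    (ht : R.HasType 0 v) :
    ∃ c ∈ R.children v, R.HasType 3 c ∧ ∀ d ∈ R.children v, d ≠ c → R.HasType 0 d := by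
  obtain ⟨⟨u1, u2⟩, u3, u4⟩ := h.unmarked hv hm
  obtain ⟨t1, t2, t3⟩ := ht
  simp at t1 t2 t3
  have e2 := eq_of_sum_eq (fun c _ => R.β_le_γ c) (s := R.children v) (by omega)
  have e3 := eq_of_sum_eq (fun c _ => R.γ_le_δ c) (s := R.children v) (by omega)
  obtain ⟨c, hc, hc1, hc2⟩ := exists_unique_increment (fun c _ => R.α_le_β c)
    (s := R.children v) (by omega)
  refine ⟨c, hc, ?_, fun d hd hne => ?_⟩
  · have := e2 c hc
    have := e3 c hc
    refine ⟨?_, ?_, ?_⟩ <;> simp <;> omega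
  · have := e2 d hd
    have := e3 d hd
    have := hc2 d hd hne
    refine ⟨?_, ?_, ?_⟩ <;> simp <;> omega

theorem Tight.children_of_one (h : R.Tight) {v : V} (hv : v ∈ R.core) (hm : v ∉ R.marked)
    (ht : R.HasType 1 v) : ∀ d ∈ R.children v, R.HasType 0 d := by
  intro d hd
  obtain ⟨⟨u1, u2⟩, u3, u4⟩ := h.unmarked hv hm
  obtain ⟨t1, t2, t3⟩ := ht
  simp at t1 t2 t3
  have := eq_of_sum_eq (fun c _ => R.α_le_β c) (s := R.children v) (by omega) d hd
  have := eq_of_sum_eq (fun c _ => R.β_le_γ c) (s := R.children v) (by omega) d hd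
  have := eq_of_sum_eq (fun c _ => R.γ_le_δ c) (s := R.children v) (by omega) d hd
  refine ⟨?_, ?_, ?_⟩ <;> simp <;> omega

/-- Here the children's `δ - γ` sum to 1, and `γ_le` excludes additional children of type 0. -/
theorem Tight.children_of_two (h : R.Tight) {v : V} (hv : v ∈ R.core) (hm : v ∉ R.marked)
    (ht : R.HasType 2 v) : ∃ c, R.children v = {c} ∧ R.HasType 1 c := by
  classical
  obtain ⟨⟨u1, u2⟩, u3, u4⟩ := h.unmarked hv hm
  obtain ⟨t1, t2, t3⟩ := ht
  simp at t1 t2 t3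
  have e1 := eq_of_sum_eq (fun c _ => R.α_le_β c) (s := R.children v) (by omega)
  have e2 := eq_of_sum_eq (fun c _ => R.β_le_γ c) (s := R.children v) (by omega)
  obtain ⟨c, hs, hc⟩ := exists_eq_singleton_of_increment (s := R.children v)
    (f := R.β) (g := R.δ) (fun c _ => (R.β_le_γ c).trans (R.γ_le_δ c)) (by omega)
    (fun c hc => by have := R.γ_le hc; omega)
  have hm : c ∈ R.children v := by simp [hs]
  have := e1 c hm
  have := e2 c hm
  refine ⟨c, hs, ?_, ?_, ?_⟩ <;> simp <;> omega

theorem Tight.children_of_three (h : R.Tight) {v : V} (hv : v ∈ R.core) (hm : v ∉ R.marked)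
    (ht : R.HasType 3 v) : ∃ c, R.children v = {c} ∧ R.HasType 2 c := by
  classical
  obtain ⟨⟨u1, u2⟩, u3, u4⟩ := h.unmarked hv hm
  obtain ⟨t1, t2, t3⟩ := ht
  simp at t1 t2 t3
  have e1 := eq_of_sum_eq (fun c _ => R.α_le_β c) (s := R.children v) (by omega)
  have e3 := eq_of_sum_eq (fun c _ => R.γ_le_δ c) (s := R.children v) (by omega)
  obtain ⟨c, hs, hc⟩ := exists_eq_singleton_of_increment (s := R.children v)
    (f := R.β) (g := R.δ) (fun c _ => (R.β_le_γ c).trans (R.γ_le_δ c)) (by omega)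
    (fun c hc => by have := R.γ_le hc; omega)
  have hm : c ∈ R.children v := by simp [hs]
  have := e1 c hm
  have := e3 c hm
  refine ⟨c, hs, ?_, ?_, ?_⟩ <;> simp <;> omega

end MarkedRooting

/-! ### Leaves and support vertices -/

theorem mem_leafSet_iff {G : SimpleGraph V} {v : V} :
    v ∈ leafSet G ↔ ∃ u, G.neighborSet v = {u} := Set.ncard_eq_one

theorem not_mem_leafSet_of_adj {G : SimpleGraph V} {v u w : V} (hu : G.Adj v u) (hw : G.Adj v w)
    (h : u ≠ w) : v ∉ leafSet G := by
  rw [mem_leafSet_iff]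
  rintro ⟨x, hx⟩
  have h1 : u ∈ G.neighborSet v := hu
  have h2 : w ∈ G.neighborSet v := hw
  rw [hx, Set.mem_singleton_iff] at h1 h2
  exact h (h1.trans h2.symm)

theorem exists_adj_ne_of_not_mem_leafSet {G : SimpleGraph V} {v u : V} (hv : v ∉ leafSet G)
    (hu : G.Adj v u) : ∃ w, G.Adj v w ∧ w ≠ u := by
  by_contra! h
  exact hv (mem_leafSet_iff.2 ⟨u, Set.eq_singleton_iff_unique_mem.2 ⟨hu, h⟩⟩)

theorem neighborSet_eq_of_mem_leafSet {G : SimpleGraph V} {v u : V} (hv : v ∈ leafSet G)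
    (hu : G.Adj v u) : G.neighborSet v = {u} := by
  obtain ⟨w, hw⟩ := mem_leafSet_iff.1 hv
  have h1 : u ∈ G.neighborSet v := hu
  rw [hw, Set.mem_singleton_iff] at h1
  rw [hw, h1]

theorem eq_of_adj_of_mem_leafSet {G : SimpleGraph V} {v u w : V} (hv : v ∈ leafSet G)
    (hu : G.Adj v u) (hw : G.Adj v w) : u = w := by
  by_contra h
  exact not_mem_leafSet_of_adj hu hw h hv

/-- Two adjacent leaves form a whole component, which would then be the graph. -/
theorem not_mem_leafSet_of_mem_supportSet [Fintype V] {G : SimpleGraph V} (hG : G.Connected)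
    (hn : 3 ≤ Fintype.card V) {v : V} (hv : v ∈ supportSet G) : v ∉ leafSet G := by
  classical
  obtain ⟨u, hu, hvu⟩ := hv
  intro hv
  have key : ∀ a b (p : G.Walk a b), a = u ∨ a = v → b = u ∨ b = v := by
    intro a b p
    induction p with
    | nil => exact id
    | cons h _ ih =>
      rintro (rfl | rfl)
      · exact ih (Or.inr (eq_of_adj_of_mem_leafSet hu h hvu.symm))
      · exact ih (Or.inl (eq_of_adj_of_mem_leafSet hv h hvu))
  have : (Finset.univ : Finset V) ⊆ {u, v} := by
    intro w _
    obtain ⟨p⟩ := hG.preconnected u w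
    simpa using key _ _ p (Or.inl rfl)
  have h1 := Finset.card_le_card this
  have h2 := Finset.card_le_two (a := u) (b := v)
  rw [Finset.card_univ] at h1
  omega

/-- The rooting comes from the leaves and the support vertices of `T`. -/
structure MarkedRooting.IsStandard {T : SimpleGraph V} (R : MarkedRooting T) : Prop where
  mem_core : ∀ v, v ∈ R.core ↔ v ∉ leafSet T
  mem_marked : ∀ v, v ∈ R.marked ↔ v ∈ supportSet T
  hasChildren : R.HasChildren

theorem exists_isStandard [Fintype V] {T : SimpleGraph V} (hT : T.IsTree)
    (hn : 3 ≤ Fintype.card V) (hs : 2 ≤ (supportSet T).ncard) :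
    ∃ R : MarkedRooting T, R.IsStandard := by
  classical
  obtain ⟨r, hr, r', hr', hne⟩ := (Set.one_lt_ncard (Set.toFinite _)).1 hs
  obtain ⟨parent, hlevel, hadj⟩ := exists_parent hT r
  have hsup : ∀ v, v ∈ supportSet T → v ∉ leafSet T := fun v hv =>
    not_mem_leafSet_of_mem_supportSet hT.1 hn hv
  let R : MarkedRooting T :=
    { root := r
      parent := parent
      level := fun v => T.dist v r
      core := Finset.univ.filter (· ∉ leafSet T)
      marked := Finset.univ.filter (· ∈ supportSet T)
      level_eq := hlevel
      adj_iff := hadj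
      parent_mem := by
        intro v _ hvr
        simp only [Finset.mem_filter, Finset.mem_univ, true_and]
        by_cases hp : parent v = r
        · exact hp ▸ hsup r hr
        · refine not_mem_leafSet_of_adj (u := v) (w := parent (parent v))
            ((hadj _ _).2 (Or.inr ⟨hvr, rfl⟩)) ((hadj _ _).2 (Or.inl ⟨hp, rfl⟩)) fun h => ?_
          have h1 := hlevel v hvr
          have h2 := hlevel _ hp
          rw [← h] at h2
          omega
      root_mem_marked := by simpa using hr
      marked_subset := by
        intro v hv
        simp only [Finset.mem_filter, Finset.mem_univ, true_and] at hv ⊢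
        exact hsup v hv }
  have hcore : ∀ v, v ∈ R.core ↔ v ∉ leafSet T := by simp [R]
  have hmarked : ∀ v, v ∈ R.marked ↔ v ∈ supportSet T := by simp [R]
  refine ⟨R, hcore, hmarked, ?_⟩
  rintro v hv h
  by_cases hvr : v = R.root
  · subst hvr
    -- The second support vertex `r'` lies in the core below the root, so the root has a child. This
    -- is where `2 ≤ s` is needed.
    rcases MarkedRooting.eq_or_mem_desc_child
      (MarkedRooting.mem_desc_root ((hcore r').2 (hsup r' hr'))) with h | ⟨c, hc, _⟩
    · exact absurd h.symm hne
    · exact ⟨c, hc⟩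
  · have hm := h.resolve_right hvr
    obtain ⟨w, hw, hwp⟩ := exists_adj_ne_of_not_mem_leafSet ((hcore v).1 hv)
      ((hadj v _).2 (Or.inl ⟨hvr, rfl⟩))
    refine ⟨w, R.mem_children.2 ⟨(hcore w).2 fun hw' => hm ((hmarked v).2 ⟨w, hw', hw⟩), ?_⟩⟩
    rcases (hadj v w).1 hw with h | h
    · exact absurd h.2.symm hwp
    · exact h

/-! ### From subtree costs to the isolation number -/

namespace MarkedRooting

variable {T : SimpleGraph V} {R : MarkedRooting T}

/-- Edges at a leaf are settled by domination of the support vertex, all others by the condition on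
core edges. -/
theorem IsStandard.isolationNumber_le_β_root [Fintype V] (h : R.IsStandard) :
    isolationNumber T ≤ R.β R.root := by
  obtain ⟨Q, hQ, hc⟩ := R.exists_card_eq_β_root
  refine hc ▸ isolationNumber_le (isIsolating_iff.2 fun u v huv => ?_)
  by_cases hu : u ∈ leafSet T
  · have hv := (h.mem_marked v).2 ⟨u, hu, huv.symm⟩
    exact Or.inr (hQ.1 v (R.marked_subset hv) hv)
  by_cases hv : v ∈ leafSet T
  · have hu := (h.mem_marked u).2 ⟨v, hv, huv⟩
    exact Or.inl (hQ.1 u (R.marked_subset hu) hu)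
  exact hQ.2 u ((h.mem_core u).2 hu) v ((h.mem_core v).2 hv) huv

theorem IsStandard.card_core [Fintype V] (h : R.IsStandard) :
    R.core.card + (leafSet T).ncard = Fintype.card V := by
  have : (R.core : Set V) = (leafSet T)ᶜ := by
    ext v
    simpa using h.mem_core v
  rw [← Set.ncard_coe_finset, this, add_comm, Set.ncard_add_ncard_compl, Nat.card_eq_fintype_card]

theorem IsStandard.card_marked [Fintype V] (h : R.IsStandard) :
    R.marked.card = (supportSet T).ncard := by
  have : (R.marked : Set V) = supportSet T := by
    ext v
    simpa using h.mem_marked v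
  rw [← Set.ncard_coe_finset, this]

end MarkedRooting

theorem four_mul_isolationNumber_le [Fintype V] {T : SimpleGraph V} (hT : T.IsTree)
    (hn : 3 ≤ Fintype.card V) (hs : 2 ≤ (supportSet T).ncard) :
    4 * isolationNumber T + (leafSet T).ncard ≤ Fintype.card V + 2 * (supportSet T).ncard := by
  obtain ⟨R, hR⟩ := exists_isStandard hT hn hs
  have h1 := MarkedRooting.four_mul_β_root_le_sum hR.hasChildren
  have h2 := hR.isolationNumber_le_β_root
  have h3 := hR.card_core
  have h4 := hR.card_marked
  rw [R.sum_weight] at h1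
  omega

/-! ### Types along parents in the equality case -/

namespace MarkedRooting

variable {T : SimpleGraph V} {R : MarkedRooting T}

theorem IsStandard.tight [Fintype V] (h : R.IsStandard)
    (heq : 4 * isolationNumber T + (leafSet T).ncard =
      Fintype.card V + 2 * (supportSet T).ncard) : R.Tight := by
  refine ⟨h.hasChildren, ?_⟩
  have h1 := four_mul_β_root_le_sum h.hasChildren
  have h2 := h.isolationNumber_le_β_root
  have h3 := h.card_core
  have h4 := h.card_marked
  rw [R.sum_weight] at h1 ⊢
  omega

theorem IsStandard.mem_core_of_adj (h : R.IsStandard) {v w : V} (hv : v ∉ R.marked)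
    (hw : T.Adj v w) : w ∈ R.core :=
  (h.mem_core w).2 fun hl => hv ((h.mem_marked v).2 ⟨w, hl, hw⟩)

theorem eq_parent_or_mem_children {v w : V} (h : T.Adj v w) (hw : w ∈ R.core) :
    (v ≠ R.root ∧ w = R.parent v) ∨ w ∈ R.children v := by
  rcases (R.adj_iff v w).1 h with h | h
  · exact Or.inl ⟨h.1, h.2.symm⟩
  · exact Or.inr (R.mem_children.2 ⟨hw, h⟩)

theorem mem_children_parent {v : V} (hv : v ∈ R.core) (hvr : v ≠ R.root) :
    v ∈ R.children (R.parent v) := R.mem_children.2 ⟨hv, hvr, rfl⟩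

theorem ne_root_of_not_mem_marked {v : V} (hv : v ∉ R.marked) : v ≠ R.root := by
  rintro rfl
  exact hv R.root_mem_marked

variable [Fintype V]

theorem Tight.parent_not_mem_marked (h : R.Tight) {v : V} (hv : v ∈ R.core) (hvr : v ≠ R.root)
    (hp : R.parent v ≠ R.root) : R.parent v ∉ R.marked := by
  intro hm
  have h1 := (h.marked hm hp).1
  have h2 := mem_children_parent hv hvr
  rw [h1] at h2
  exact absurd h2 (Finset.notMem_empty v)

theorem Tight.parent_ne_root (h : R.Tight) {v : V} (hv : v ∈ R.core) (hvr : v ≠ R.root)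
    {i : Fin 4} (ht : R.HasType i v) (hi : i ≠ 1) : R.parent v ≠ R.root := by
  intro hp
  obtain ⟨c, hc, hc1⟩ := h.root
  have h2 := mem_children_parent hv hvr
  rw [hp, hc, Finset.mem_singleton] at h2
  subst h2
  exact hi (ht.eq hc1)

/-- The rules for children read upwards: each nonzero type of `v` occurs below only one type of
parent. -/
theorem Tight.parent_type (h : R.Tight) {v : V} (hv : v ∈ R.core) (hvr : v ≠ R.root)
    (hp : R.parent v ≠ R.root) {i : Fin 4} (ht : R.HasType i v) :
    (i = 3 → R.HasType 0 (R.parent v)) ∧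
    (i = 2 → R.HasType 3 (R.parent v) ∧ R.children (R.parent v) = {v}) ∧
    (i = 1 → R.HasType 2 (R.parent v) ∧ R.children (R.parent v) = {v}) := by
  have hm := h.parent_not_mem_marked hv hvr hp
  have hc := R.parent_mem v hv hvr
  have hch := mem_children_parent hv hvr
  obtain ⟨j, hj⟩ := h.hasType hc hm
  have h0 : j = 0 → i = 0 ∨ i = 3 := by
    rintro rfl
    obtain ⟨c, _, hc3, hc0⟩ := h.children_of_zero hc hm hj
    by_cases hvc : v = c
    · exact Or.inr (ht.eq (hvc ▸ hc3))
    · exact Or.inl (ht.eq (hc0 v hch hvc))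
  have h1 : j = 1 → i = 0 := by
    rintro rfl
    exact ht.eq (h.children_of_one hc hm hj v hch)
  have h2 : j = 2 → i = 1 ∧ R.children (R.parent v) = {v} := by
    rintro rfl
    obtain ⟨c, hs, hc1⟩ := h.children_of_two hc hm hj
    rw [hs, Finset.mem_singleton] at hch
    rw [hs, hch]
    exact ⟨ht.eq (hch ▸ hc1), rfl⟩
  have h3 : j = 3 → i = 2 ∧ R.children (R.parent v) = {v} := by
    rintro rfl
    obtain ⟨c, hs, hc1⟩ := h.children_of_three hc hm hj
    rw [hs, Finset.mem_singleton] at hch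
    rw [hs, hch]
    exact ⟨ht.eq (hch ▸ hc1), rfl⟩
  have hj' : j = 0 ∨ j = 1 ∨ j = 2 ∨ j = 3 := by fin_cases j <;> simp
  rcases hj' with rfl | rfl | rfl | rfl
  · have := h0 rfl
    refine ⟨fun _ => hj, ?_, ?_⟩ <;> rintro rfl <;> simp at this
  · have := h1 rfl
    subst this
    simp
  · obtain ⟨rfl, hs⟩ := h2 rfl
    exact ⟨by simp, by simp, fun _ => ⟨hj, hs⟩⟩
  · obtain ⟨rfl, hs⟩ := h3 rfl
    exact ⟨by simp, fun _ => ⟨hj, hs⟩, by simp⟩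

end MarkedRooting

/-! ### Decomposition of the core into paths -/

namespace MarkedRooting

variable {T : SimpleGraph V} (R : MarkedRooting T)

/-- The core is partitioned into the edges `b (a b)` with `b` marked and the paths
`x₁ y, y₁ y, y, x₂ y` with `y ∈ Y`. The function `kind` tells apart the unmarked vertices of
the different kinds. -/
structure Decomposition where
  /-- the neighbor in the core of a marked vertex -/
  a : V → V
  /-- the set of chosen inner vertices of the paths -/
  Y : Finset V
  /-- the end of the path next to `y₁ y` -/
  x₁ : V → V
  /-- the other inner vertex of the path -/
  y₁ : V → V
  /-- the end of the path next to `y` -/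
  x₂ : V → V
  /-- the kind of an unmarked vertex -/
  kind : V → Fin 5
  adj_a : ∀ b ∈ R.marked, T.Adj b (a b)
  eq_a : ∀ b ∈ R.marked, ∀ w ∈ R.core, T.Adj b w → w = a b
  adj_x₁ : ∀ y ∈ Y, T.Adj (x₁ y) (y₁ y)
  adj_y₁ : ∀ y ∈ Y, T.Adj (y₁ y) y
  adj_x₂ : ∀ y ∈ Y, T.Adj y (x₂ y)
  eq_of_adj_y₁ : ∀ y ∈ Y, ∀ w ∈ R.core, T.Adj (y₁ y) w → w = x₁ y ∨ w = y
  eq_of_adj : ∀ y ∈ Y, ∀ w ∈ R.core, T.Adj y w → w = y₁ y ∨ w = x₂ y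
  mem_a : ∀ b ∈ R.marked, a b ∈ R.core ∧ a b ∉ R.marked ∧ kind (a b) = 0
  mem_x₁ : ∀ y ∈ Y, x₁ y ∈ R.core ∧ x₁ y ∉ R.marked ∧ kind (x₁ y) = 1
  mem_y₁ : ∀ y ∈ Y, y₁ y ∈ R.core ∧ y₁ y ∉ R.marked ∧ kind (y₁ y) = 2
  mem_y : ∀ y ∈ Y, y ∈ R.core ∧ y ∉ R.marked ∧ kind y = 3
  mem_x₂ : ∀ y ∈ Y, x₂ y ∈ R.core ∧ x₂ y ∉ R.marked ∧ kind (x₂ y) = 4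
  inj_a : Set.InjOn a R.marked
  inj_x₁ : Set.InjOn x₁ Y
  inj_y₁ : Set.InjOn y₁ Y
  inj_x₂ : Set.InjOn x₂ Y
  cover : ∀ v ∈ R.core, v ∉ R.marked →
    (∃ b ∈ R.marked, v = a b) ∨ ∃ y ∈ Y, v = x₁ y ∨ v = y₁ y ∨ v = y ∨ v = x₂ y

variable {R}

theorem Tight.exists_decomposition [Fintype V] (h : R.Tight) : Nonempty R.Decomposition := by
  classical
  obtain ⟨c₀, hroot, hc₀⟩ := h.root
  have hc₀' : c₀ ∈ R.children R.root := by simp [hroot]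
  have hc₀c := (R.mem_children.1 hc₀').1
  have hc₀r := (R.mem_children.1 hc₀').2.1
  have hc₀p := (R.mem_children.1 hc₀').2.2
  have hc₀m : c₀ ∉ R.marked := fun hm => by
    have := hc₀.eq (h.marked hm hc₀r).2
    simp at this
  let Y : Finset V := R.core.filter fun v => v ∉ R.marked ∧ R.HasType 2 v
  have hY : ∀ y, y ∈ Y ↔ y ∈ R.core ∧ y ∉ R.marked ∧ R.HasType 2 y := by simp [Y]
  have hex : ∀ y, ∃ x, y ∈ Y → R.children y = {x} ∧ R.HasType 1 x := by
    intro y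
    by_cases hy : y ∈ Y
    · obtain ⟨hc, hm, ht⟩ := (hY y).1 hy
      obtain ⟨x, hx⟩ := h.children_of_two hc hm ht
      exact ⟨x, fun _ => hx⟩
    · exact ⟨y, fun h => absurd h hy⟩
  choose x₂ hx₂ using hex
  have hx₂m : ∀ y ∈ Y, x₂ y ∈ R.core ∧ x₂ y ∉ R.marked ∧ x₂ y ≠ R.root ∧ R.parent (x₂ y) = y ∧
      x₂ y ∈ R.children y := by
    intro y hy
    have hch : x₂ y ∈ R.children y := by simp [(hx₂ y hy).1]
    obtain ⟨h1, h2, h3⟩ := R.mem_children.1 hch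
    refine ⟨h1, fun hm => ?_, h2, h3, hch⟩
    have := (hx₂ y hy).2.eq (h.marked hm h2).2
    simp at this
  have hy₁ : ∀ y ∈ Y, R.parent y ∈ R.core ∧ R.parent y ∉ R.marked ∧ R.parent y ≠ R.root ∧
      R.HasType 3 (R.parent y) ∧ R.children (R.parent y) = {y} := by
    intro y hy
    obtain ⟨hc, hm, ht⟩ := (hY y).1 hy
    have hr := ne_root_of_not_mem_marked hm
    have hp := h.parent_ne_root hc hr ht (by simp)
    exact ⟨R.parent_mem y hc hr, h.parent_not_mem_marked hc hr hp, hp,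
      (h.parent_type hc hr hp ht).2.1 rfl⟩
  -- A vertex of type 0 has only one child of type 3, so it belongs to only one path: as `a` if that
  -- child is marked, as `x₁` if not.
  have hthree : ∀ y, y ∈ R.core → y ≠ R.root → R.HasType 3 y → R.parent y ∈ R.core ∧
      R.parent y ∉ R.marked ∧ R.HasType 0 (R.parent y) ∧
      ∀ c ∈ R.children (R.parent y), R.HasType 3 c → c = y := by
    intro y hc hr ht
    have hp := h.parent_ne_root hc hr ht (by simp)
    have hm := h.parent_not_mem_marked hc hr hp
    have h0 := (h.parent_type hc hr hp ht).1 rfl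
    have hpc := R.parent_mem y hc hr
    refine ⟨hpc, hm, h0, fun c hcc ht' => ?_⟩
    obtain ⟨d, hd, hd3, hd0⟩ := h.children_of_zero hpc hm h0
    have key : ∀ e ∈ R.children (R.parent y), R.HasType 3 e → e = d := by
      intro e he he3
      by_contra hne
      have := he3.eq (hd0 e he hne)
      simp at this
    rw [key c hcc ht', key y (mem_children_parent hc hr) ht]
  let a : V → V := fun b => if b = R.root then c₀ else R.parent b
  have ha : ∀ b ∈ R.marked, b ≠ R.root → a b = R.parent b := fun b _ hb => if_neg hb
  have haroot : a R.root = c₀ := if_pos rfl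
  -- Types 2 and 3 are the inner vertices `y` and `y₁`. Type 1 is an end `x₂`, except for the child
  -- of the root, which is the root's `a`. Type 0 is `a` or `x₁` according to its child of type 3.
  let kind : V → Fin 5 := fun v =>
    if R.HasType 2 v then 3 else if R.HasType 3 v then 2 else
    if R.HasType 1 v then (if R.parent v = R.root then 0 else 4) else
    if ∃ b ∈ R.marked, b ∈ R.children v then 0 else 1
  have hkind : ∀ v (i j : Fin 4), i ≠ j → R.HasType i v → ¬ R.HasType j v := fun v i j hij hi hj =>
    hij (hi.eq hj)
  have hmem_a : ∀ b ∈ R.marked, a b ∈ R.core ∧ a b ∉ R.marked ∧ kind (a b) = 0 := by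
    intro b hb
    by_cases hbr : b = R.root
    · subst hbr
      rw [haroot]
      refine ⟨hc₀c, hc₀m, ?_⟩
      simp [kind, hc₀, hc₀p, hkind _ 1 2 (by simp) hc₀, hkind _ 1 3 (by simp) hc₀]
    · rw [ha b hb hbr]
      have hbc := R.marked_subset hb
      obtain ⟨h1, h2, h3, h4⟩ := hthree b hbc hbr (h.marked hb hbr).2
      refine ⟨h1, h2, ?_⟩
      have : ∃ b' ∈ R.marked, b' ∈ R.children (R.parent b) :=
        ⟨b, hb, mem_children_parent hbc hbr⟩
      simp only [kind, hkind _ 0 2 (by simp) h3, hkind _ 0 3 (by simp) h3,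
        hkind _ 0 1 (by simp) h3, if_false, if_pos this]
  refine ⟨{
    a := a
    Y := Y
    x₁ := fun y => R.parent (R.parent y)
    y₁ := R.parent
    x₂ := x₂
    kind := kind
    adj_a := ?_
    eq_a := ?_
    adj_x₁ := fun y hy => adj_child (mem_children_parent (hy₁ y hy).1 (hy₁ y hy).2.2.1)
    adj_y₁ := fun y hy => adj_child (mem_children_parent ((hY y).1 hy).1
      (ne_root_of_not_mem_marked ((hY y).1 hy).2.1))
    adj_x₂ := fun y hy => adj_child (hx₂m y hy).2.2.2.2
    eq_of_adj_y₁ := ?_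
    eq_of_adj := ?_
    mem_a := hmem_a
    mem_x₁ := ?_
    mem_y₁ := ?_
    mem_y := ?_
    mem_x₂ := ?_
    inj_a := ?_
    inj_x₁ := ?_
    inj_y₁ := ?_
    inj_x₂ := ?_
    cover := ?_ }⟩
  · intro b hb
    by_cases hbr : b = R.root
    · subst hbr
      exact haroot ▸ adj_child hc₀'
    · rw [ha b hb hbr]
      exact (adj_child (mem_children_parent (R.marked_subset hb) hbr)).symm
  · intro b hb w hw hbw
    rcases eq_parent_or_mem_children hbw hw with hp | hc
    · rw [ha b hb hp.1, hp.2]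
    · by_cases hbr : b = R.root
      · subst hbr
        rwa [hroot, Finset.mem_singleton, ← haroot] at hc
      · rw [(h.marked hb hbr).1] at hc
        exact absurd hc (Finset.notMem_empty w)
  · intro y hy w hw hyw
    rcases eq_parent_or_mem_children hyw hw with hp | hc
    · exact Or.inl hp.2
    · rw [(hy₁ y hy).2.2.2.2, Finset.mem_singleton] at hc
      exact Or.inr hc
  · intro y hy w hw hyw
    rcases eq_parent_or_mem_children hyw hw with hp | hc
    · exact Or.inl hp.2
    · rw [(hx₂ y hy).1, Finset.mem_singleton] at hc
      exact Or.inr hc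
  · intro y hy
    obtain ⟨k1, k2, k3, k4, k5⟩ := hy₁ y hy
    obtain ⟨h1, h2, h3, h4⟩ := hthree _ k1 k3 k4
    refine ⟨h1, h2, ?_⟩
    have : ¬ ∃ b' ∈ R.marked, b' ∈ R.children (R.parent (R.parent y)) := by
      rintro ⟨b, hb, hbc⟩
      exact k2 (h4 b hbc (h.marked hb (R.mem_children.1 hbc).2.1).2 ▸ hb)
    simp only [kind, hkind _ 0 2 (by simp) h3, hkind _ 0 3 (by simp) h3,
      hkind _ 0 1 (by simp) h3, if_false, if_neg this]
  · intro y hy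
    obtain ⟨k1, k2, k3, k4, k5⟩ := hy₁ y hy
    exact ⟨k1, k2, by simp only [kind, hkind _ 3 2 (by simp) k4, if_false, if_pos k4]⟩
  · intro y hy
    obtain ⟨k1, k2, k3⟩ := (hY y).1 hy
    exact ⟨k1, k2, if_pos k3⟩
  · intro y hy
    obtain ⟨k1, k2, k3, k4, k5⟩ := hx₂m y hy
    have ht := (hx₂ y hy).2
    have hyr := ne_root_of_not_mem_marked ((hY y).1 hy).2.1
    refine ⟨k1, k2, ?_⟩
    simp only [kind, hkind _ 1 2 (by simp) ht, hkind _ 1 3 (by simp) ht, if_false, if_pos ht, k4,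
      if_neg hyr]
  · intro b hb b' hb' heq
    have key : ∀ b ∈ R.marked, b ≠ R.root → c₀ ≠ a b := by
      intro b hb hbr he
      rw [ha b hb hbr] at he
      have h3 := (hthree b (R.marked_subset hb) hbr (h.marked hb hbr).2).2.2.1
      rw [← he] at h3
      simpa using hc₀.eq h3
    by_cases hbr : b = R.root <;> by_cases hbr' : b' = R.root
    · rw [hbr, hbr']
    · rw [hbr, haroot] at heq
      exact absurd heq (key b' hb' hbr')
    · rw [hbr', haroot] at heq
      exact absurd heq.symm (key b hb hbr)
    · rw [ha b hb hbr, ha b' hb' hbr'] at heq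
      refine ((hthree b' (R.marked_subset hb') hbr' (h.marked hb' hbr').2).2.2.2 b ?_
        (h.marked hb hbr).2)
      exact heq ▸ mem_children_parent (R.marked_subset hb) hbr
  · intro y hy y' hy' heq
    obtain ⟨k1, k2, k3, k4, k5⟩ := hy₁ y hy
    obtain ⟨k1', k2', k3', k4', k5'⟩ := hy₁ y' hy'
    have := (hthree _ k1' k3' k4').2.2.2 (R.parent y)
      (by have := mem_children_parent k1 k3; simp only at heq; rwa [heq] at this) k4
    rw [this, k5'] at k5
    simpa using k5.symm
  · intro y hy y' hy' heq
    obtain ⟨k1, k2, k3, k4, k5⟩ := hy₁ y hy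
    obtain ⟨k1', k2', k3', k4', k5'⟩ := hy₁ y' hy'
    rw [heq, k5'] at k5
    simpa using k5.symm
  · intro y hy y' hy' heq
    rw [← (hx₂m y hy).2.2.2.1, heq, (hx₂m y' hy').2.2.2.1]
  · intro v hv hm
    have hr := ne_root_of_not_mem_marked hm
    obtain ⟨i, hi⟩ := h.hasType hv hm
    have hi' : i = 0 ∨ i = 1 ∨ i = 2 ∨ i = 3 := by fin_cases i <;> simp
    have h3 : ∀ v ∈ R.core, v ∉ R.marked → R.HasType 3 v → ∃ y ∈ Y, v = R.parent y := by
      intro v hv hm hi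
      obtain ⟨y, hs, hy⟩ := h.children_of_three hv hm hi
      have hyc : y ∈ R.children v := by simp [hs]
      obtain ⟨y1, y2, y3⟩ := R.mem_children.1 hyc
      refine ⟨y, (hY y).2 ⟨y1, fun hm => ?_, hy⟩, y3.symm⟩
      simpa using hy.eq (h.marked hm y2).2
    rcases hi' with rfl | rfl | rfl | rfl
    · obtain ⟨c, hc, hc3, -⟩ := h.children_of_zero hv hm hi
      obtain ⟨c1, c2, c3⟩ := R.mem_children.1 hc
      by_cases hcm : c ∈ R.marked
      · exact Or.inl ⟨c, hcm, by rw [ha c hcm c2, c3]⟩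
      · obtain ⟨y, hy, rfl⟩ := h3 c c1 hcm hc3
        exact Or.inr ⟨y, hy, Or.inl c3.symm⟩
    · by_cases hp : R.parent v = R.root
      · have := mem_children_parent hv hr
        rw [hp, hroot, Finset.mem_singleton] at this
        exact Or.inl ⟨R.root, R.root_mem_marked, by rw [haroot, this]⟩
      · obtain ⟨h2, hs⟩ := (h.parent_type hv hr hp hi).2.2 rfl
        have hy : R.parent v ∈ Y :=
          (hY _).2 ⟨R.parent_mem v hv hr, h.parent_not_mem_marked hv hr hp, h2⟩
        refine Or.inr ⟨R.parent v, hy, Or.inr (Or.inr (Or.inr ?_))⟩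
        have := (hx₂ _ hy).1
        rw [hs] at this
        simpa using this
    · exact Or.inr ⟨v, (hY v).2 ⟨hv, hm, hi⟩, by simp⟩
    · obtain ⟨y, hy, rfl⟩ := h3 v hv hm hi
      exact Or.inr ⟨y, hy, by simp⟩

end MarkedRooting

/-! ### Equality implies membership in the family -/

theorem pathUnion_adj_inl {r q : ℕ} {i j : Fin r} {k l : Fin 3} :
    (pathUnion r q).Adj (Sum.inl (i, k)) (Sum.inl (j, l)) ↔ (pathGraph 3).Adj k l ∧ i = j := by
  simp [pathUnion, boxProd_adj]

theorem pathUnion_adj_inr {r q : ℕ} {i j : Fin q} {k l : Fin 4} :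
    (pathUnion r q).Adj (Sum.inr (i, k)) (Sum.inr (j, l)) ↔ (pathGraph 4).Adj k l ∧ i = j := by
  simp [pathUnion, boxProd_adj]

theorem not_pathUnion_adj_inl_inr {r q : ℕ} {x : Fin r × Fin 3} {y : Fin q × Fin 4} :
    ¬ (pathUnion r q).Adj (Sum.inl x) (Sum.inr y) := by
  simp [pathUnion]

theorem not_pathUnion_adj_inr_inl {r q : ℕ} {x : Fin r × Fin 3} {y : Fin q × Fin 4} :
    ¬ (pathUnion r q).Adj (Sum.inr y) (Sum.inl x) := by
  simp [pathUnion]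

namespace MarkedRooting

variable {T : SimpleGraph V} {R : MarkedRooting T}

/-- The range of `f` is closed under parents, so following parents leads from any vertex to the root
inside it. -/
theorem connected_comap {W : Type*} (f : W → V) (hcore : ∀ v ∈ R.core, v ∈ Set.range f)
    (hf : ∀ w, f w ≠ R.root → R.parent (f w) ∈ R.core) (hinj : Function.Injective f) :
    (T.comap f).Connected := by
  obtain ⟨w₀, hw₀⟩ := hcore _ R.root_mem
  have key : ∀ n w, R.level (f w) = n → (T.comap f).Reachable w w₀ := by
    intro n
    induction n with
    | zero =>
      intro w hw
      by_cases hr : f w = R.root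
      · rw [hinj (hr.trans hw₀.symm)]
      · have := R.level_eq _ hr
        omega
    | succ n ih =>
      intro w hw
      by_cases hr : f w = R.root
      · rw [hinj (hr.trans hw₀.symm)]
      · obtain ⟨w', hw'⟩ := hcore _ (hf w hr)
        have hadj : (T.comap f).Adj w w' := by
          rw [comap_adj, hw']
          exact (R.adj_iff _ _).2 (Or.inl ⟨hr, rfl⟩)
        refine hadj.reachable.trans (ih w' ?_)
        have := R.level_eq _ hr
        rw [hw']
        omega
  exact { preconnected := fun u v => (key _ u rfl).trans (key _ v rfl).symm
          nonempty := ⟨w₀⟩ }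

theorem IsStandard.exists_isJoinOfPaths [Fintype V] (hT : T.IsTree) (hR : R.IsStandard)
    (h : R.Tight) : ∃ (q : ℕ) (f : PathVertex R.marked.card q ↪ V),
      IsJoinOfPaths (T.comap f) ∧ ∀ v ∉ Set.range f, v ∈ leafSet T ∧
        ∃ u ∈ leafSet (T.comap f), T.neighborSet v = T.neighborSet (f u) := by
  classical
  obtain ⟨D⟩ := h.exists_decomposition
  have hleaf : ∀ b, ∃ c, b ∈ R.marked → c ∈ leafSet T ∧ T.Adj b c := by
    intro b
    by_cases hb : b ∈ R.marked
    · obtain ⟨c, hc⟩ := (hR.mem_marked b).1 hb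
      exact ⟨c, fun _ => hc⟩
    · exact ⟨b, fun h => absurd h hb⟩
  choose leaf hleaf using hleaf
  let σ : Fin R.marked.card → V := fun i => R.marked.equivFin.symm i
  let τ : Fin D.Y.card → V := fun j => D.Y.equivFin.symm j
  have hσ : ∀ i, σ i ∈ R.marked := fun i => (R.marked.equivFin.symm i).2
  have hτ : ∀ j, τ j ∈ D.Y := fun j => (D.Y.equivFin.symm j).2
  have hσi : Function.Injective σ :=
    Subtype.val_injective.comp R.marked.equivFin.symm.injective
  have hτi : Function.Injective τ := Subtype.val_injective.comp D.Y.equivFin.symm.injective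
  have hσs : ∀ b ∈ R.marked, ∃ i, σ i = b := fun b hb => ⟨R.marked.equivFin ⟨b, hb⟩, by simp [σ]⟩
  have hτs : ∀ y ∈ D.Y, ∃ j, τ j = y := fun y hy => ⟨D.Y.equivFin ⟨y, hy⟩, by simp [τ]⟩
  let F : PathVertex R.marked.card D.Y.card → V :=
    Sum.elim (fun p => ![D.a (σ p.1), σ p.1, leaf (σ p.1)] p.2)
      (fun p => ![D.x₁ (τ p.1), D.y₁ (τ p.1), τ p.1, D.x₂ (τ p.1)] p.2)
  have F0 : ∀ i, F (Sum.inl (i, 0)) = D.a (σ i) := fun i => rfl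
  have F1 : ∀ i, F (Sum.inl (i, 1)) = σ i := fun i => rfl
  have F2 : ∀ i, F (Sum.inl (i, 2)) = leaf (σ i) := fun i => rfl
  have G0 : ∀ j, F (Sum.inr (j, 0)) = D.x₁ (τ j) := fun i => rfl
  have G1 : ∀ j, F (Sum.inr (j, 1)) = D.y₁ (τ j) := fun i => rfl
  have G2 : ∀ j, F (Sum.inr (j, 2)) = τ j := fun i => rfl
  have G3 : ∀ j, F (Sum.inr (j, 3)) = D.x₂ (τ j) := fun i => rfl
  have hleafc : ∀ i, leaf (σ i) ∉ R.core := fun i hc =>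
    (hR.mem_core _).1 hc (hleaf _ (hσ i)).1
  -- the vertices of the seven kinds
  let K : V → Fin 7 := fun v =>
    if v ∉ R.core then 6 else if v ∈ R.marked then 5 else (D.kind v).castLE (by norm_num)
  have K0 : ∀ i, K (D.a (σ i)) = 0 := fun i => by
    obtain ⟨h1, h2, h3⟩ := D.mem_a _ (hσ i)
    simp [K, h1, h2, h3]
  have K1 : ∀ i, K (σ i) = 5 := fun i => by simp [K, R.marked_subset (hσ i), hσ i]
  have K2 : ∀ i, K (leaf (σ i)) = 6 := fun i => by simp [K, hleafc i]
  have L0 : ∀ j, K (D.x₁ (τ j)) = 1 := fun j => by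
    obtain ⟨h1, h2, h3⟩ := D.mem_x₁ _ (hτ j)
    simp [K, h1, h2, h3]
  have L1 : ∀ j, K (D.y₁ (τ j)) = 2 := fun j => by
    obtain ⟨h1, h2, h3⟩ := D.mem_y₁ _ (hτ j)
    simp [K, h1, h2, h3]
  have L2 : ∀ j, K (τ j) = 3 := fun j => by
    obtain ⟨h1, h2, h3⟩ := D.mem_y _ (hτ j)
    simp [K, h1, h2, h3]
  have L3 : ∀ j, K (D.x₂ (τ j)) = 4 := fun j => by
    obtain ⟨h1, h2, h3⟩ := D.mem_x₂ _ (hτ j)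
    simp [K, h1, h2, h3]
  have hleafi : ∀ i j, T.Adj (leaf (σ i)) (σ j) → j = i := fun i j hij =>
    hσi (eq_of_adj_of_mem_leafSet (hleaf _ (hσ i)).1 hij (hleaf _ (hσ i)).2.symm)
  have hKF : ∀ w, K (F w) =
      Sum.elim (fun p => (![0, 5, 6] : Fin 3 → Fin 7) p.2)
        (fun p => (![1, 2, 3, 4] : Fin 4 → Fin 7) p.2) w := by
    rintro (⟨i, k⟩ | ⟨j, k⟩)
    · fin_cases k
      · exact K0 i
      · exact K1 i
      · exact K2 i
    · fin_cases k
      · exact L0 j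
      · exact L1 j
      · exact L2 j
      · exact L3 j
  have hinj : Function.Injective F := by
    intro u w huw
    have hK := congrArg K huw
    rw [hKF, hKF] at hK
    rcases u with ⟨i, k⟩ | ⟨i, k⟩ <;> rcases w with ⟨j, l⟩ | ⟨j, l⟩
    · have hkl : k = l := (show ∀ k l : Fin 3, (![0, 5, 6] : Fin 3 → Fin 7) k = ![0, 5, 6] l → k = l
        by decide) k l hK
      subst hkl
      have : i = j := by
        fin_cases k
        · exact hσi (D.inj_a (hσ i) (hσ j) huw)
        · exact hσi huw
        · refine hleafi j i ?_
          have h2 : leaf (σ i) = leaf (σ j) := huw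
          rw [← h2]
          exact (hleaf _ (hσ i)).2.symm
      rw [this]
    · exact absurd hK ((show ∀ (k : Fin 3) (l : Fin 4), (![0, 5, 6] : Fin 3 → Fin 7) k ≠
        (![1, 2, 3, 4] : Fin 4 → Fin 7) l by decide) k l)
    · exact absurd hK ((show ∀ (k : Fin 4) (l : Fin 3), (![1, 2, 3, 4] : Fin 4 → Fin 7) k ≠
        (![0, 5, 6] : Fin 3 → Fin 7) l by decide) k l)
    · have hkl : k = l := (show ∀ k l : Fin 4, (![1, 2, 3, 4] : Fin 4 → Fin 7) k = ![1, 2, 3, 4] l → k = l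
        by decide) k l hK
      subst hkl
      have : i = j := by
        fin_cases k
        · exact hτi (D.inj_x₁ (hτ i) (hτ j) huw)
        · exact hτi (D.inj_y₁ (hτ i) (hτ j) huw)
        · exact hτi huw
        · exact hτi (D.inj_x₂ (hτ i) (hτ j) huw)
      rw [this]
  have hcore : ∀ v ∈ R.core, v ∈ Set.range F := by
    intro v hv
    by_cases hm : v ∈ R.marked
    · obtain ⟨i, rfl⟩ := hσs v hm
      exact ⟨_, F1 i⟩
    · rcases D.cover v hv hm with ⟨b, hb, rfl⟩ | ⟨y, hy, hvy⟩
      · obtain ⟨i, rfl⟩ := hσs b hb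
        exact ⟨_, F0 i⟩
      · obtain ⟨j, rfl⟩ := hτs y hy
        rcases hvy with rfl | rfl | rfl | rfl
        · exact ⟨_, G0 j⟩
        · exact ⟨_, G1 j⟩
        · exact ⟨_, G2 j⟩
        · exact ⟨_, G3 j⟩
  have hF : ∀ w, (∃ i, w = Sum.inl (i, 2)) ∨ F w ∈ R.core := by
    rintro (⟨i, k⟩ | ⟨j, k⟩)
    · fin_cases k
      · exact Or.inr (D.mem_a _ (hσ i)).1
      · exact Or.inr (R.marked_subset (hσ i))
      · exact Or.inl ⟨i, rfl⟩
    · fin_cases k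
      · exact Or.inr (D.mem_x₁ _ (hτ j)).1
      · exact Or.inr (D.mem_y₁ _ (hτ j)).1
      · exact Or.inr (D.mem_y _ (hτ j)).1
      · exact Or.inr (D.mem_x₂ _ (hτ j)).1
  have hAX : ∀ w ∈ setAX R.marked.card D.Y.card, F w ∈ R.core ∧ F w ∉ R.marked := by
    rintro w (⟨i, rfl⟩ | ⟨j, rfl⟩ | ⟨j, rfl⟩)
    · exact ⟨(D.mem_a _ (hσ i)).1, (D.mem_a _ (hσ i)).2.1⟩
    · exact ⟨(D.mem_x₁ _ (hτ j)).1, (D.mem_x₁ _ (hτ j)).2.1⟩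
    · exact ⟨(D.mem_x₂ _ (hτ j)).1, (D.mem_x₂ _ (hτ j)).2.1⟩
  -- The neighbours in the image of a vertex labelled `b`, `c` or `y` are all known and are its
  -- neighbours on its own path.
  have hadded : ∀ u v, T.Adj (F u) (F v) → ¬ (pathUnion _ _).Adj u v →
      u ∈ setAX R.marked.card D.Y.card := by
    rintro (⟨i, k⟩ | ⟨j, k⟩) v huv hnp
    · fin_cases k
      · exact Or.inl ⟨i, rfl⟩
      · exfalso
        change T.Adj (σ i) (F v) at huv
        rcases hF v with ⟨i', rfl⟩ | hv
        · obtain rfl := hleafi i' i huv.symm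
          exact hnp (pathUnion_adj_inl.2 ⟨by simp [pathGraph_adj], rfl⟩)
        · have := D.eq_a _ (hσ i) _ hv huv
          rw [← F0] at this
          rw [hinj this] at hnp
          exact hnp (pathUnion_adj_inl.2 ⟨by simp [pathGraph_adj], rfl⟩)
      · exfalso
        change T.Adj (leaf (σ i)) (F v) at huv
        have := eq_of_adj_of_mem_leafSet (hleaf _ (hσ i)).1 huv (hleaf _ (hσ i)).2.symm
        rw [← F1] at this
        rw [hinj this] at hnp
        exact hnp (pathUnion_adj_inl.2 ⟨by simp [pathGraph_adj], rfl⟩)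
    · fin_cases k
      · exact Or.inr (Or.inl ⟨j, rfl⟩)
      · exfalso
        change T.Adj (D.y₁ (τ j)) (F v) at huv
        rcases D.eq_of_adj_y₁ _ (hτ j) _ (hR.mem_core_of_adj (D.mem_y₁ _ (hτ j)).2.1 huv) huv
          with this | this
        · rw [← G0] at this
          rw [hinj this] at hnp
          exact hnp (pathUnion_adj_inr.2 ⟨by simp [pathGraph_adj], rfl⟩)
        · rw [← G2] at this
          rw [hinj this] at hnp
          exact hnp (pathUnion_adj_inr.2 ⟨by simp [pathGraph_adj], rfl⟩)
      · exfalso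
        change T.Adj (τ j) (F v) at huv
        rcases D.eq_of_adj _ (hτ j) _ (hR.mem_core_of_adj (D.mem_y _ (hτ j)).2.1 huv) huv
          with this | this
        · rw [← G1] at this
          rw [hinj this] at hnp
          exact hnp (pathUnion_adj_inr.2 ⟨by simp [pathGraph_adj], rfl⟩)
        · rw [← G3] at this
          rw [hinj this] at hnp
          exact hnp (pathUnion_adj_inr.2 ⟨by simp [pathGraph_adj], rfl⟩)
      · exact Or.inr (Or.inr ⟨j, rfl⟩)
  refine ⟨D.Y.card, ⟨F, hinj⟩, ⟨⟨?_, ?_⟩, ?_, ?_, ?_⟩, ?_⟩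
  · refine connected_comap F hcore (fun w hw => ?_) hinj
    rcases hF w with ⟨i, rfl⟩ | hc
    · have hadj : T.Adj (leaf (σ i)) (R.parent (leaf (σ i))) := (R.adj_iff _ _).2 (Or.inl ⟨hw, rfl⟩)
      change R.parent (leaf (σ i)) ∈ R.core
      rw [eq_of_adj_of_mem_leafSet (hleaf _ (hσ i)).1 hadj (hleaf _ (hσ i)).2.symm]
      exact R.marked_subset (hσ i)
    · exact R.parent_mem _ hc hw
  · exact hT.isAcyclic.comap ⟨F, fun h => h⟩ hinj
  · rintro (⟨i, k⟩ | ⟨i, k⟩) (⟨j, l⟩ | ⟨j, l⟩) huv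
    · obtain ⟨hkl, rfl⟩ := pathUnion_adj_inl.1 huv
      have e1 : T.Adj (F (Sum.inl (i, 0))) (F (Sum.inl (i, 1))) := (D.adj_a _ (hσ i)).symm
      have e2 : T.Adj (F (Sum.inl (i, 1))) (F (Sum.inl (i, 2))) := (hleaf _ (hσ i)).2
      rw [pathGraph_adj] at hkl
      fin_cases k <;> fin_cases l <;>
        first
        | exact e1
        | exact e1.symm
        | exact e2
        | exact e2.symm
        | (exfalso; simp at hkl)
    · exact absurd huv not_pathUnion_adj_inl_inr
    · exact absurd huv not_pathUnion_adj_inr_inl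
    · obtain ⟨hkl, rfl⟩ := pathUnion_adj_inr.1 huv
      have e1 : T.Adj (F (Sum.inr (i, 0))) (F (Sum.inr (i, 1))) := D.adj_x₁ _ (hτ i)
      have e2 : T.Adj (F (Sum.inr (i, 1))) (F (Sum.inr (i, 2))) := D.adj_y₁ _ (hτ i)
      have e3 : T.Adj (F (Sum.inr (i, 2))) (F (Sum.inr (i, 3))) := D.adj_x₂ _ (hτ i)
      rw [pathGraph_adj] at hkl
      fin_cases k <;> fin_cases l <;>
        first
        | exact e1
        | exact e1.symm
        | exact e2
        | exact e2.symm
        | exact e3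
        | exact e3.symm
        | (exfalso; simp at hkl)
  · exact fun u v huv hnp => ⟨hadded u v huv hnp, hadded v u huv.symm fun h => hnp h.symm⟩
  · intro w hw hl
    obtain ⟨hc, hm⟩ := hAX w hw
    obtain ⟨u, hu⟩ := mem_leafSet_iff.1 hl
    -- `F w` is not a support vertex, so all its neighbours in `T` are in the core, hence in the
    -- range of `F`. A leaf of the copy would thus be a leaf of `T`.
    refine (hR.mem_core _).1 hc (mem_leafSet_iff.2 ⟨F u, ?_⟩)
    ext v
    have key : ∀ v', T.Adj (F w) (F v') ↔ v' = u := fun v' => by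
      have : v' ∈ (T.comap F).neighborSet w ↔ v' = u := by
        rw [← Set.mem_singleton_iff, ← hu]
        rfl
      exact this
    constructor
    · intro hv
      obtain ⟨v', rfl⟩ := hcore v (hR.mem_core_of_adj hm hv)
      rw [(key v').1 hv]
      rfl
    · rintro rfl
      exact (key u).2 rfl
  · intro v hv
    have hvl : v ∈ leafSet T := by
      by_contra hl
      exact hv (hcore v ((hR.mem_core v).2 hl))
    obtain ⟨b, hb⟩ := mem_leafSet_iff.1 hvl
    have hvb : T.Adj v b := by
      rw [← mem_neighborSet, hb]
      rfl
    have hbm : b ∈ R.marked := (hR.mem_marked b).2 ⟨v, hvl, hvb.symm⟩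
    obtain ⟨i, rfl⟩ := hσs b hbm
    obtain ⟨hl, hla⟩ := hleaf _ (hσ i)
    refine ⟨hvl, Sum.inl (i, 2), mem_leafSet_iff.2 ⟨Sum.inl (i, 1), ?_⟩, ?_⟩
    · ext w
      constructor
      · intro hw
        exact hinj (eq_of_adj_of_mem_leafSet hl hw hla.symm)
      · rintro rfl
        exact hla.symm
    · exact hb.trans (neighborSet_eq_of_mem_leafSet hl hla.symm).symm

end MarkedRooting

/-! ### Membership in the family implies equality -/

theorem mem_leafSet_of_iso {W : Type*} {G : SimpleGraph V} {H : SimpleGraph W} (φ : G ≃g H)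
    {v : V} (hv : v ∈ leafSet G) : φ v ∈ leafSet H := by
  obtain ⟨u, hu⟩ := mem_leafSet_iff.1 hv
  refine mem_leafSet_iff.2 ⟨φ u, ?_⟩
  ext w
  obtain ⟨w, rfl⟩ := φ.surjective w
  have : w ∈ G.neighborSet v ↔ w = u := by rw [hu, Set.mem_singleton_iff]
  rw [mem_neighborSet, φ.map_adj_iff, Set.mem_singleton_iff, φ.injective.eq_iff]
  exact this

namespace IsJoinOfPaths

variable {r q : ℕ} {H : SimpleGraph (PathVertex r q)}

theorem pathUnion_adj (hH : IsJoinOfPaths H) {u v : PathVertex r q} (hu : u ∉ setAX r q)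
    (huv : H.Adj u v) : (pathUnion r q).Adj u v := by
  by_contra h
  exact hu (hH.added_edge u v huv h).1

theorem adj_inl (hH : IsJoinOfPaths H) (i : Fin r) {k l : Fin 3} (h : (pathGraph 3).Adj k l) :
    H.Adj (Sum.inl (i, k)) (Sum.inl (i, l)) := hH.pathUnion_le (pathUnion_adj_inl.2 ⟨h, rfl⟩)

theorem adj_inr (hH : IsJoinOfPaths H) (j : Fin q) {k l : Fin 4} (h : (pathGraph 4).Adj k l) :
    H.Adj (Sum.inr (j, k)) (Sum.inr (j, l)) := hH.pathUnion_le (pathUnion_adj_inr.2 ⟨h, rfl⟩)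

theorem not_mem_leafSet (hH : IsJoinOfPaths H) {w : PathVertex r q}
    (hw : ∀ i, w ≠ Sum.inl (i, 2)) : w ∉ leafSet H := by
  rcases w with ⟨i, k⟩ | ⟨j, k⟩
  · fin_cases k
    · exact hH.not_leaf _ (Or.inl ⟨i, rfl⟩)
    · exact not_mem_leafSet_of_adj (u := Sum.inl (i, 0)) (w := Sum.inl (i, 2))
        (hH.adj_inl i (by simp [pathGraph_adj])) (hH.adj_inl i (by simp [pathGraph_adj])) (by simp)
    · exact absurd rfl (hw i)
  · fin_cases k
    · exact hH.not_leaf _ (Or.inr (Or.inl ⟨j, rfl⟩))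
    · exact not_mem_leafSet_of_adj (u := Sum.inr (j, 0)) (w := Sum.inr (j, 2))
        (hH.adj_inr j (by simp [pathGraph_adj])) (hH.adj_inr j (by simp [pathGraph_adj])) (by simp)
    · exact not_mem_leafSet_of_adj (u := Sum.inr (j, 1)) (w := Sum.inr (j, 3))
        (hH.adj_inr j (by simp [pathGraph_adj])) (hH.adj_inr j (by simp [pathGraph_adj])) (by simp)
    · exact hH.not_leaf _ (Or.inr (Or.inr ⟨j, rfl⟩))

variable {T : SimpleGraph V} (g : H ↪g T)

/-- A vertex outside of the copy of `H` is a leaf that is attached to a vertex `b`. -/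
def AttachedLeaves : Prop := ∀ v ∉ Set.range g, ∃ i, T.neighborSet v = {g (Sum.inl (i, 1))}

variable {g}

theorem exists_of_adj (hg : AttachedLeaves g) {u : PathVertex r q} {w : V}
    (h : T.Adj (g u) w) : (∃ v, H.Adj u v ∧ w = g v) ∨
      ∃ i, u = Sum.inl (i, 1) ∧ T.neighborSet w = {g (Sum.inl (i, 1))} := by
  by_cases hw : w ∈ Set.range g
  · obtain ⟨v, rfl⟩ := hw
    exact Or.inl ⟨v, g.map_adj_iff.1 h, rfl⟩
  · obtain ⟨i, hi⟩ := hg w hw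
    have : g u ∈ T.neighborSet w := h.symm
    rw [hi, Set.mem_singleton_iff] at this
    exact Or.inr ⟨i, g.injective this, hi⟩

theorem neighborSet_c (hH : IsJoinOfPaths H) (hg : AttachedLeaves g) (i : Fin r) :
    T.neighborSet (g (Sum.inl (i, 2))) = {g (Sum.inl (i, 1))} := by
  refine Set.eq_singleton_iff_unique_mem.2
    ⟨g.map_adj_iff.2 (hH.adj_inl i (by simp [pathGraph_adj])), fun w hw => ?_⟩
  rcases exists_of_adj hg hw with ⟨v, hv, rfl⟩ | ⟨i', h, _⟩
  · have := hH.pathUnion_adj (by simp [setAX]) hv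
    rcases v with ⟨i', k⟩ | v
    · obtain ⟨hk, rfl⟩ := pathUnion_adj_inl.1 this
      rw [pathGraph_adj] at hk
      fin_cases k <;> simp at hk
      rfl
    · exact absurd this not_pathUnion_adj_inl_inr
  · simp at h

theorem eq_or_of_adj_b (hH : IsJoinOfPaths H) (hg : AttachedLeaves g) {i : Fin r} {w : V}
    (h : T.Adj (g (Sum.inl (i, 1))) w) :
    w = g (Sum.inl (i, 0)) ∨ T.neighborSet w = {g (Sum.inl (i, 1))} := by
  rcases exists_of_adj hg h with ⟨v, hv, rfl⟩ | ⟨i', h, h'⟩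
  · have := hH.pathUnion_adj (by simp [setAX]) hv
    rcases v with ⟨i', k⟩ | v
    · obtain ⟨hk, rfl⟩ := pathUnion_adj_inl.1 this
      rw [pathGraph_adj] at hk
      fin_cases k
      · exact Or.inl rfl
      · simp at hk
      · exact Or.inr (hH.neighborSet_c hg i)
    · exact absurd this not_pathUnion_adj_inl_inr
  · rw [h]
    exact Or.inr h'

theorem exists_eq_of_adj_y (hH : IsJoinOfPaths H) (hg : AttachedLeaves g) {j : Fin q}
    {k : Fin 4} (hk : k = 1 ∨ k = 2) {w : V} (h : T.Adj (g (Sum.inr (j, k))) w) :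
    ∃ l, w = g (Sum.inr (j, l)) := by
  rcases exists_of_adj hg h with ⟨v, hv, rfl⟩ | ⟨i', h, h'⟩
  · have := hH.pathUnion_adj (by rcases hk with rfl | rfl <;> simp [setAX]) hv
    rcases v with v | ⟨j', l⟩
    · exact absurd this not_pathUnion_adj_inr_inl
    · obtain ⟨_, rfl⟩ := pathUnion_adj_inr.1 this
      exact ⟨l, rfl⟩
  · simp at h

theorem not_mem_leafSet_image (hH : IsJoinOfPaths H) {w : PathVertex r q}
    (hw : ∀ i, w ≠ Sum.inl (i, 2)) : g w ∉ leafSet T := by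
  intro hl
  obtain ⟨u, hu⟩ : ∃ u, H.Adj w u := by
    rcases w with ⟨i, k⟩ | ⟨j, k⟩
    · fin_cases k
      · exact ⟨_, hH.adj_inl i (l := 1) (by simp [pathGraph_adj])⟩
      · exact ⟨_, hH.adj_inl i (l := 0) (by simp [pathGraph_adj])⟩
      · exact absurd rfl (hw i)
    · fin_cases k
      · exact ⟨_, hH.adj_inr j (l := 1) (by simp [pathGraph_adj])⟩
      · exact ⟨_, hH.adj_inr j (l := 0) (by simp [pathGraph_adj])⟩
      · exact ⟨_, hH.adj_inr j (l := 1) (by simp [pathGraph_adj])⟩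
      · exact ⟨_, hH.adj_inr j (l := 2) (by simp [pathGraph_adj])⟩
  obtain ⟨v, hv, hne⟩ := exists_adj_ne_of_not_mem_leafSet (hH.not_mem_leafSet hw) hu
  exact not_mem_leafSet_of_adj (g.map_adj_iff.2 hv) (g.map_adj_iff.2 hu)
    (fun h => hne (g.injective h)) hl

theorem mem_leafSet_iff_exists (hH : IsJoinOfPaths H) (hg : AttachedLeaves g) {v : V} :
    v ∈ leafSet T ↔ ∃ i, T.neighborSet v = {g (Sum.inl (i, 1))} := by
  refine ⟨fun hv => ?_, fun ⟨i, hi⟩ => mem_leafSet_iff.2 ⟨_, hi⟩⟩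
  by_cases hr : v ∈ Set.range g
  · obtain ⟨w, rfl⟩ := hr
    by_cases hw : ∃ i, w = Sum.inl (i, 2)
    · obtain ⟨i, rfl⟩ := hw
      exact ⟨i, hH.neighborSet_c hg i⟩
    · push Not at hw
      exact absurd hv (hH.not_mem_leafSet_image hw)
  · exact hg v hr

theorem ncard_supportSet (hH : IsJoinOfPaths H) (hg : AttachedLeaves g) :
    (supportSet T).ncard = r := by
  have : supportSet T = Set.range fun i => g (Sum.inl (i, 1)) := by
    ext v
    constructor
    · rintro ⟨u, hu, hvu⟩
      obtain ⟨i, hi⟩ := (hH.mem_leafSet_iff_exists hg).1 hu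
      have : v ∈ T.neighborSet u := hvu.symm
      rw [hi] at this
      exact ⟨i, this.symm⟩
    · rintro ⟨i, rfl⟩
      exact ⟨g (Sum.inl (i, 2)), (hH.mem_leafSet_iff_exists hg).2 ⟨i, hH.neighborSet_c hg i⟩,
        g.map_adj_iff.2 (hH.adj_inl i (by simp [pathGraph_adj]))⟩
  rw [this, Set.ncard_range_of_injective, Nat.card_fin]
  intro i j hij
  simpa using hij

/-- Only the `a`, the `b` and the vertices of the `P₄`s are not leaves. With `s = r` this gives `n -
ℓ + 2s = 4(r + q)`. -/
theorem ncard_compl_leafSet (hH : IsJoinOfPaths H) (hg : AttachedLeaves g) :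
    (leafSet T)ᶜ.ncard = 2 * r + 4 * q := by
  have : (leafSet T)ᶜ = Set.range fun x : (Fin r × Fin 2) ⊕ (Fin q × Fin 4) =>
      g (Sum.map (Prod.map id Fin.castSucc) id x) := by
    ext v
    constructor
    · intro hv
      have hr : v ∈ Set.range g := by
        by_contra h
        exact hv ((hH.mem_leafSet_iff_exists hg).2 (hg v h))
      obtain ⟨⟨i, k⟩ | y, rfl⟩ := hr
      · fin_cases k
        · exact ⟨Sum.inl (i, 0), rfl⟩
        · exact ⟨Sum.inl (i, 1), rfl⟩
        · exact absurd ((hH.mem_leafSet_iff_exists hg).2 ⟨i, hH.neighborSet_c hg i⟩) hv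
      · exact ⟨Sum.inr y, rfl⟩
    · rintro ⟨x, rfl⟩
      refine hH.not_mem_leafSet_image fun i => ?_
      rcases x with ⟨i', k⟩ | y
      · intro h
        fin_cases k <;> simp [Fin.ext_iff] at h
      · simp
  rw [this, Set.ncard_range_of_injective]
  · simp [mul_comm]
  · exact g.injective.comp (Function.Injective.sumMap
      (Function.injective_id.prodMap (Fin.castSucc_injective 2)) Function.injective_id)

/-- The cell of a `P₃` consists of `a`, `b` and all leaves at `b`, and contains the closed
neighbourhoods of both ends of `bc`; the cell of a `P₄` is its vertex set and does the same for
`yy`. Settling these edges needs an element of `D` in each cell, and the cells are disjoint. -/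
theorem le_card_of_isIsolating (hH : IsJoinOfPaths H) (hg : AttachedLeaves g) {D : Finset V}
    (hD : IsIsolating (completeGraph (Fin 2)) T (D : Set V)) : r + q ≤ D.card := by
  rw [isIsolating_iff] at hD
  let cell : Fin r ⊕ Fin q → V → Prop := Sum.elim
    (fun i d => d = g (Sum.inl (i, 0)) ∨ d = g (Sum.inl (i, 1)) ∨
      T.neighborSet d = {g (Sum.inl (i, 1))})
    (fun j d => ∃ k, d = g (Sum.inr (j, k)))
  have hcell : ∀ x, ∃ d ∈ D, cell x d := by
    rintro (i | j)
    · rcases hD _ _ (g.map_adj_iff.2 (hH.adj_inl i (k := 1) (l := 2) (by simp [pathGraph_adj])))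
        with (h | ⟨d, hd, h⟩) | (h | ⟨d, hd, h⟩)
      · exact ⟨_, h, Or.inr (Or.inl rfl)⟩
      · refine ⟨d, hd, ?_⟩
        rcases hH.eq_or_of_adj_b hg h.symm with h | h
        · exact Or.inl h
        · exact Or.inr (Or.inr h)
      · exact ⟨_, h, Or.inr (Or.inr (hH.neighborSet_c hg i))⟩
      · refine ⟨d, hd, Or.inr (Or.inl ?_)⟩
        have : d ∈ T.neighborSet (g (Sum.inl (i, 2))) := h.symm
        rwa [hH.neighborSet_c hg i] at this
    · rcases hD _ _ (g.map_adj_iff.2 (hH.adj_inr j (k := 1) (l := 2) (by simp [pathGraph_adj])))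
        with (h | ⟨d, hd, h⟩) | (h | ⟨d, hd, h⟩)
      · exact ⟨_, h, 1, rfl⟩
      · exact ⟨d, hd, hH.exists_eq_of_adj_y hg (Or.inl rfl) h.symm⟩
      · exact ⟨_, h, 2, rfl⟩
      · exact ⟨d, hd, hH.exists_eq_of_adj_y hg (Or.inr rfl) h.symm⟩
  choose d hdD hd using hcell
  have hleaf : ∀ w i, (∀ i', w ≠ Sum.inl (i', 2)) →
      T.neighborSet (g w) ≠ {g (Sum.inl (i, 1))} := fun w i hw h =>
    hH.not_mem_leafSet_image hw (mem_leafSet_iff.2 ⟨_, h⟩)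
  have hdisj : ∀ x y v, cell x v → cell y v → x = y := by
    rintro (i | j) (i' | j') v hx hy
    · rcases hx with rfl | rfl | hx <;> rcases hy with hy | hy | hy
      · simpa using hy
      · simp at hy
      · exact absurd hy (hleaf _ _ (by simp))
      · simp at hy
      · simpa using hy
      · exact absurd hy (hleaf _ _ (by simp))
      · exact absurd (hy ▸ hx) (hleaf _ _ (by simp))
      · exact absurd (hy ▸ hx) (hleaf _ _ (by simp))
      · simpa using hx.symm.trans hy
    · obtain ⟨k, rfl⟩ := hy
      rcases hx with hx | hx | hx
      · simp at hx
      · simp at hx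
      · exact absurd hx (hleaf _ _ (by simp))
    · obtain ⟨k, rfl⟩ := hx
      rcases hy with hx | hx | hx
      · simp at hx
      · simp at hx
      · exact absurd hx (hleaf _ _ (by simp))
    · obtain ⟨k, rfl⟩ := hx
      obtain ⟨l, hl⟩ := hy
      simp at hl
      simp [hl.1]
  have := Finset.card_le_card_of_injOn (s := Finset.univ) (t := D) d (fun x _ => hdD x)
    fun x _ y _ hxy => hdisj x y (d x) (hd x) (hxy ▸ hd y)
  simpa using this

end IsJoinOfPaths

/-- Every leaf of `H` is labelled `c`, so a twin of it is attached to the vertex `b` of the same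
path. -/
theorem exists_attachedLeaves {W : Type*} {T : SimpleGraph V} {T₀ : SimpleGraph W} {r q : ℕ}
    {H : SimpleGraph (PathVertex r q)} (hH : IsJoinOfPaths H) (e : T₀ ≃g H)
    (h : AddTwinLeaves T₀ T) : ∃ g : H ↪g T, IsJoinOfPaths.AttachedLeaves g := by
  obtain ⟨f, hf⟩ := h
  refine ⟨f.comp e.symm.toEmbedding, fun v hv => ?_⟩
  have hv' : v ∉ Set.range f := by
    rintro ⟨w, rfl⟩
    exact hv ⟨e w, by simp⟩
  obtain ⟨hl, u, hu, huv⟩ := hf v hv'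
  have hu' := mem_leafSet_of_iso e hu
  obtain ⟨i, hi⟩ : ∃ i, e u = Sum.inl (i, 2) := by
    by_contra! hne
    exact hH.not_mem_leafSet hne hu'
  refine ⟨i, neighborSet_eq_of_mem_leafSet hl ?_⟩
  rw [← mem_neighborSet, huv, mem_neighborSet]
  have : f u = (f.comp e.symm.toEmbedding) (Sum.inl (i, 2)) := by
    rw [← hi]
    simp
  rw [this, Embedding.map_adj_iff]
  exact hH.adj_inl i (by simp [pathGraph_adj])

end TreeIsolation

/-! ### The characterization -/

theorem mainTheorem9 {V : Type u} [Fintype V] (T : SimpleGraph V) (hT : T.IsTree)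
    (n ℓ s : ℕ) (hn : n = Fintype.card V)
    (hℓ : ℓ = (TreeIsolation.leafSet T).ncard)
    (hs : s = (TreeIsolation.supportSet T).ncard)
    (hn3 : 3 ≤ n) (hs2 : 2 ≤ s) :
    (TreeIsolation.isolationNumber T : ℚ) = ((n : ℚ) - ℓ + 2 * s) / 4 ↔
      ∃ (W : Type u) (T₀ : SimpleGraph W),
        TreeIsolation.InFamilyF T₀ ∧ TreeIsolation.AddTwinLeaves T₀ T := by
  subst hn hℓ hs
  have hiff : (TreeIsolation.isolationNumber T : ℚ) =
      ((Fintype.card V : ℚ) - (TreeIsolation.leafSet T).ncard +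
        2 * (TreeIsolation.supportSet T).ncard) / 4 ↔
      4 * TreeIsolation.isolationNumber T + (TreeIsolation.leafSet T).ncard =
        Fintype.card V + 2 * (TreeIsolation.supportSet T).ncard := by
    rw [← Nat.cast_inj (R := ℚ)]
    push_cast
    constructor <;> intro h <;> linarith
  rw [hiff]
  constructor
  · intro heq
    obtain ⟨R, hR⟩ := TreeIsolation.exists_isStandard hT hn3 hs2
    obtain ⟨q, f, hf, htwin⟩ := hR.exists_isJoinOfPaths hT (hR.tight heq)
    -- `PathVertex` lives in `Type`, whereas `W` has to be in `Type u`.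
    let e : (T.comap f).comap (ULift.down : ULift.{u} _ → _) ≃g T.comap f :=
      ⟨Equiv.ulift, Iff.rfl⟩
    refine ⟨ULift.{u} _, (T.comap f).comap ULift.down,
      ⟨_, q, T.comap f, hR.card_marked.symm ▸ hs2, hf, ⟨e⟩⟩,
      (SimpleGraph.Embedding.comap f T).comp e.toEmbedding, fun v hv => ?_⟩
    obtain ⟨hl, u, hu, huv⟩ := htwin v (by
      rintro ⟨w, rfl⟩
      exact hv ⟨e.symm w, rfl⟩)
    exact ⟨hl, e.symm u, TreeIsolation.mem_leafSet_of_iso e.symm hu, huv⟩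
  · rintro ⟨W, T₀, ⟨r, q, H, -, hH, ⟨e⟩⟩, hadd⟩
    obtain ⟨g, hg⟩ := TreeIsolation.exists_attachedLeaves hH e hadd
    obtain ⟨D, hD, hcard⟩ := TreeIsolation.exists_card_eq_isolationNumber T
    have h1 := hH.le_card_of_isIsolating hg hD
    have h2 := hH.ncard_compl_leafSet hg
    have h3 := hH.ncard_supportSet hg
    have h4 := TreeIsolation.four_mul_isolationNumber_le hT hn3 hs2
    have h5 := Set.ncard_add_ncard_compl (TreeIsolation.leafSet T)
    rw [Nat.card_eq_fintype_card] at h5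
    -- The lower bound `r + q` meets the general upper bound, since `n - ℓ = 2r + 4q` and `s = r`.
    omega
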